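/- **Setting.** Let $\nu>0$, $\mathbb{R}_+=(0,\infty)$, $\partial_\nu=\partial_x+(\nu-\tfrac12)x^{-1}$, $\partial_\nu^*=-\partial_x+(\nu-\tfrac12)x^{-1}$, $D_\nu=-i\partial_\nu$, and $|D_\nu|^2=\partial_\nu^*\partial_\nu=-\partial_x^2+(\nu^2-\tfrac14)x^{-2}$. Let $\langle u,v\rangle=\int_{\mathbb{R}_+}u\bar v\,dx$. With derivatives in the sense of distributions on $\mathbb{R}_+$, put $\mathcal{H}^0=L^2(\mathbb{R}_+)$, $$\mathcal{H}^1=\{u\in L^2:\partial_\nu u\in L^2\},\quad \|u\|_{\mathcal{H}^1}^2=\|u\|^2+\|\partial_\nu u\|^2,$$ $$\mathcal{H}^2=\{u\in\mathcal{H}^1:\partial_\nu^*\partial_\nu u\in L^2\},\quad \|u\|_{\mathcal{H}^2}^2=\|u\|_{\mathcal{H}^1}^2+\|\partial_\nu^*\partial_\nu u\|^2,$$ and let $\mathcal{H}^{-s}$ ($s=1,2$) be the space of continuous antilinear functionals on $\mathcal{H}^s$. Fix $a\in\mathbb{C}$ and $P=|D_\nu|^2+a$. $P$ is called regular if $a\notin(-\infty,0]$.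 **Case $0<\nu<1$.** Define $\gamma_-u=\lim_{x\to0+}x^{\nu-1/2}u(x)$ on $\mathcal{H}^1$ and $\gamma_+u=\lim_{x\to0+}x^{1/2-\nu}\partial_\nu u(x)$ on $\mathcal{H}^2$. Let $\widetilde{\mathcal{H}}^s$ be the space of $(u,\phi_-,\phi_+)\in\mathcal{H}^s\times\mathbb{C}^2$ such that $\phi_\pm=\gamma_\pm u$ if $s=2$, $\phi_-=\gamma_-u$ if $s=1$, and with no condition if $s=0$; its norm is $(\|u\|_{\mathcal{H}^s}^2+|\phi_-|^2+|\phi_+|^2)^{1/2}$. Then $P$ acts as a bounded operator $\widetilde{\mathcal{H}}^s\to\mathcal{H}^{s-2}$ by $P(u,\phi)=|D_\nu|^2u+au$ if $s=2$, and by $$\langle P(u,\phi),v\rangle=\langle D_\nu u,D_\nu v\rangle+a\langle u,v\rangle+\phi_+\overline{\gamma_-v}\quad(s=1,\ v\in\mathcal{H}^1),$$ $$\langle P(u,\phi),v\rangle=\langle u,(|D_\nu|^2+\bar a)v\rangle+\phi_+\overline{\gamma_-v}-\phi_-\overline{\gamma_+v}\quad(s=0,\ v\in\mathcal{H}^2).$$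 Let $J\ge0$ be an integer, $G\in\mathbb{C}^{(J+1)\times2}$, $C\in\mathbb{C}^{(J+1)\times J}$, and $Tu=G(\gamma_-u,\gamma_+u)^\top$. Put $\mathscr{P}(u,\phi,\underline u)=(P(u,\phi),\,G\phi+C\underline u)$, where $\phi=(\phi_-,\phi_+)^\top$. Let $\mathcal{M}_+$ be the space of solutions of $Pu=0$ on $\mathbb{R}_+$ that are bounded as $x\to\infty$. The operator $\mathscr{P}=\{P,T,C\}$ is called regular if the only $(u,\underline u)\in\mathcal{M}_+\times\mathbb{C}^J$ with $Tu+C\underline u=0$ is $(0,0)$. **Case $\nu\ge1$.** $P$ acts as a bounded operator $\mathcal{H}^s\to\mathcal{H}^{s-2}$ by the same formulas without the boundary terms. **Proposition.** 1. Let $0<\nu<1$, and suppose that $P$ and $\mathscr{P}$ are regular. Then, for $s=0,1,2$, $$\mathscr{P}:\widetilde{\mathcal{H}}^s\times\mathbb{C}^J\to\mathcal{H}^{s-2}\times\mathbb{C}^{J+1}$$ is an isomorphism (bounded, with bounded inverse). On the set of all $(a,G,C)$ for which $P$ and $\mathscr{P}$ are regular, $\mathscr{P}^{-1}$ depends continuously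 on $(a,G,C)$ in the operator norm; in particular so does $\|\mathscr{P}^{-1}\|$. 2. Let $\nu\ge1$, and suppose that $P$ is regular. Then, for $s=0,1,2$, $P:\mathcal{H}^s\to\mathcal{H}^{s-2}$ is an isomorphism, and on $\mathbb{C}\setminus(-\infty,0]$ the inverse $P^{-1}$, and in particular $\|P^{-1}\|$, depends continuously on $a$ in the operator norm. -/

import Mathlib

open MeasureTheory Set Filter Topology
open scoped ContDiff
noncomputable section
namespace BesselBVP

/-- Complex test functions in `C_c^∞(ℝ₊)`, `ℝ₊ = (0, ∞)`. -/
def IsTestFunction (φ : ℝ → ℂ) : Prop :=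
  ContDiff ℝ ∞ φ ∧ HasCompactSupport φ ∧ tsupport φ ⊆ Ioi (0 : ℝ)

/-- `∂_ν f = f' + (ν - 1/2) x⁻¹ f`. -/
def bd (ν : ℝ) (f : ℝ → ℂ) (x : ℝ) : ℂ := deriv f x + ((ν - 1 / 2) / x : ℝ) * f x

/-- The formal adjoint `∂_ν^* f = -f' + (ν - 1/2) x⁻¹ f`; `|D_ν|² = ∂_ν^* ∂_ν`. -/
def bdStar (ν : ℝ) (f : ℝ → ℂ) (x : ℝ) : ℂ := -deriv f x + ((ν - 1 / 2) / x : ℝ) * f x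

/-- `∂_ν u = w` in the sense of distributions on `ℝ₊`. -/
def IsWeakD (ν : ℝ) (u w : ℝ → ℂ) : Prop :=
  ∀ φ : ℝ → ℂ, IsTestFunction φ →
    ∫ x in Ioi (0 : ℝ), u x * bdStar ν φ x = ∫ x in Ioi (0 : ℝ), w x * φ x

/-- `∂_ν^* w = z` in the sense of distributions on `ℝ₊`. -/
def IsWeakDStar (ν : ℝ) (w z : ℝ → ℂ) : Prop :=
  ∀ φ : ℝ → ℂ, IsTestFunction φ →
    ∫ x in Ioi (0 : ℝ), w x * bd ν φ x = ∫ x in Ioi (0 : ℝ), z x * φ x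

/-- `L²(ℝ₊)`, complex valued, with Lebesgue measure. -/
abbrev L2 : Type := Lp ℂ 2 (volume.restrict (Ioi (0 : ℝ)))

lemma mulIntegrable (u : L2) {f : ℝ → ℂ} (hf : Continuous f) (hc : HasCompactSupport f) :
    IntegrableOn (fun x => u x * f x) (Ioi (0 : ℝ)) := by
  have h1 : MemLp f 2 (volume.restrict (Ioi (0 : ℝ))) :=
    (hf.memLp_of_hasCompactSupport hc).restrict _
  exact (Lp.memLp u).integrable_mul h1

lemma IsTestFunction.zero_near {φ : ℝ → ℂ} (h : IsTestFunction φ) : ∀ᶠ x in 𝓝 (0:ℝ), φ x = 0 := by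
  have : (0:ℝ) ∉ tsupport φ := fun h0 => lt_irrefl (0:ℝ) (h.2.2 h0)
  exact notMem_tsupport_iff_eventuallyEq.1 this

/-- `c / x * φ x` is continuous with compact support -/
lemma IsTestFunction.div_cont {φ : ℝ → ℂ} (h : IsTestFunction φ) (c : ℝ) :
    Continuous (fun x : ℝ => ((c / x : ℝ) : ℂ) * φ x) := by
  rw [continuous_iff_continuousAt]
  intro x
  by_cases hx : x = 0
  · subst hx
    refine (continuousAt_const (y := (0:ℂ))).congr ?_
    filter_upwards [h.zero_near] with y hy
    simp [hy]
  · have : ContinuousAt (fun x : ℝ => c / x) x := continuousAt_const.div continuousAt_id hx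
    exact (Complex.continuous_ofReal.continuousAt.comp this).mul h.1.continuous.continuousAt

lemma IsTestFunction.bd_cont {φ : ℝ → ℂ} (h : IsTestFunction φ) (ν : ℝ) :
    Continuous (bd ν φ) ∧ HasCompactSupport (bd ν φ) :=
  ⟨(h.1.continuous_deriv (by simp)).add (h.div_cont _), h.2.1.deriv.add (h.2.1.mul_left)⟩

lemma IsTestFunction.bdStar_cont {φ : ℝ → ℂ} (h : IsTestFunction φ) (ν : ℝ) :
    Continuous (bdStar ν φ) ∧ HasCompactSupport (bdStar ν φ) :=
  ⟨(h.1.continuous_deriv (by simp)).neg.add (h.div_cont _), h.2.1.deriv.neg.add (h.2.1.mul_left)⟩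

lemma pair_add (u v : L2) {f : ℝ → ℂ} (hf : Continuous f) (hc : HasCompactSupport f) :
    ∫ x in Ioi (0 : ℝ), (u + v : L2) x * f x
      = (∫ x in Ioi (0 : ℝ), u x * f x) + ∫ x in Ioi (0 : ℝ), v x * f x := by
  rw [← integral_add (mulIntegrable u hf hc) (mulIntegrable v hf hc)]
  refine integral_congr_ae ?_
  filter_upwards [Lp.coeFn_add u v] with x hx
  rw [hx, Pi.add_apply, add_mul]

lemma pair_smul (c : ℂ) (u : L2) (f : ℝ → ℂ) :
    ∫ x in Ioi (0 : ℝ), (c • u : L2) x * f x = c * ∫ x in Ioi (0 : ℝ), u x * f x := by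
  rw [← integral_const_mul]
  refine integral_congr_ae ?_
  filter_upwards [Lp.coeFn_smul c u] with x hx
  rw [hx, Pi.smul_apply, smul_eq_mul, mul_assoc]

lemma pair_zero (f : ℝ → ℂ) : ∫ x in Ioi (0 : ℝ), (0 : L2) x * f x = 0 := by
  have := pair_smul 0 0 f
  simpa using this

/-- Pairs `(u, w)` of `L²` functions with `∂_ν u = w` in the sense of distributions. -/
def H1Submodule (ν : ℝ) : Submodule ℂ (WithLp 2 (L2 × L2)) where
  carrier := {U | IsWeakD ν U.fst U.snd}
  zero_mem' := fun φ _ => by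
    simp only [WithLp.zero_fst, WithLp.zero_snd]; rw [pair_zero, pair_zero]
  add_mem' := fun {U V} hU hV φ hφ => by
    obtain ⟨h1, h2⟩ := hφ.bdStar_cont ν
    simp only [WithLp.add_fst, WithLp.add_snd]
    rw [pair_add _ _ h1 h2, pair_add _ _ hφ.1.continuous hφ.2.1, hU φ hφ, hV φ hφ]
  smul_mem' := fun c U hU φ hφ => by
    simp only [WithLp.smul_fst, WithLp.smul_snd]
    rw [pair_smul, pair_smul, hU φ hφ]

/-- `ℋ¹(ℝ₊)`: an element `u` is recorded together with its distributional derivative `∂_ν u`,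
so that `‖u‖² = ‖u‖²_{L²} + ‖∂_ν u‖²_{L²}`. -/
def H1 (ν : ℝ) : Type := H1Submodule ν

instance (ν : ℝ) : NormedAddCommGroup (H1 ν) :=
  inferInstanceAs (NormedAddCommGroup (H1Submodule ν))

instance (ν : ℝ) : InnerProductSpace ℂ (H1 ν) :=
  inferInstanceAs (InnerProductSpace ℂ (H1Submodule ν))

namespace H1

/-- The underlying `L²` function. -/
def incl (ν : ℝ) : H1 ν →L[ℂ] L2 := (WithLp.fstL 2 ℂ L2 L2).comp (H1Submodule ν).subtypeL

/-- The derivative `∂_ν u`. -/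
def d (ν : ℝ) : H1 ν →L[ℂ] L2 := (WithLp.sndL 2 ℂ L2 L2).comp (H1Submodule ν).subtypeL

lemma isWeakD {ν : ℝ} (U : H1 ν) : IsWeakD ν (incl ν U) (d ν U) := U.2

lemma norm_incl_le {ν : ℝ} (U : H1 ν) : ‖incl ν U‖ ≤ ‖U‖ := WithLp.norm_fst_le _ U.1

lemma norm_d_le {ν : ℝ} (U : H1 ν) : ‖d ν U‖ ≤ ‖U‖ := WithLp.norm_snd_le _ U.1

end H1

/-- Pairs `(u, z)` with `u ∈ ℋ¹`, `z ∈ L²` and `∂_ν^* (∂_ν u) = z` in the sense of distributions. -/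
def H2Submodule (ν : ℝ) : Submodule ℂ (WithLp 2 (H1 ν × L2)) where
  carrier := {U | IsWeakDStar ν (H1.d ν U.fst) U.snd}
  zero_mem' := fun φ _ => by
    simp only [WithLp.zero_fst, WithLp.zero_snd, map_zero]; rw [pair_zero, pair_zero]
  add_mem' := fun {U V} hU hV φ hφ => by
    obtain ⟨h1, h2⟩ := hφ.bd_cont ν
    simp only [WithLp.add_fst, WithLp.add_snd, map_add]
    rw [pair_add _ _ h1 h2, pair_add _ _ hφ.1.continuous hφ.2.1, hU φ hφ, hV φ hφ]
  smul_mem' := fun c U hU φ hφ => by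
    simp only [WithLp.smul_fst, WithLp.smul_snd, map_smul]
    rw [pair_smul, pair_smul, hU φ hφ]

/-- `ℋ²(ℝ₊)`: the `u ∈ ℋ¹` such that `∂_ν u ∈ ℋ¹_*`, i.e. `∂_ν^* ∂_ν u ∈ L²`, with
`‖u‖² = ‖∂_ν^* ∂_ν u‖²_{L²} + ‖u‖²_{ℋ¹}`. -/
def H2 (ν : ℝ) : Type := H2Submodule ν

instance (ν : ℝ) : NormedAddCommGroup (H2 ν) :=
  inferInstanceAs (NormedAddCommGroup (H2Submodule ν))

instance (ν : ℝ) : InnerProductSpace ℂ (H2 ν) :=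
  inferInstanceAs (InnerProductSpace ℂ (H2Submodule ν))

namespace H2

/-- The inclusion `ℋ² → ℋ¹`. -/
def toH1 (ν : ℝ) : H2 ν →L[ℂ] H1 ν := (WithLp.fstL 2 ℂ (H1 ν) L2).comp (H2Submodule ν).subtypeL

/-- The underlying `L²` function. -/
def incl (ν : ℝ) : H2 ν →L[ℂ] L2 := (H1.incl ν).comp (toH1 ν)

/-- The derivative `∂_ν u`. -/
def d (ν : ℝ) : H2 ν →L[ℂ] L2 := (H1.d ν).comp (toH1 ν)

/-- `|D_ν|² u = ∂_ν^* ∂_ν u`. -/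
def dd (ν : ℝ) : H2 ν →L[ℂ] L2 := (WithLp.sndL 2 ℂ (H1 ν) L2).comp (H2Submodule ν).subtypeL

lemma isWeakDStar {ν : ℝ} (U : H2 ν) : IsWeakDStar ν (d ν U) (dd ν U) := U.2

lemma norm_d_le {ν : ℝ} (U : H2 ν) : ‖d ν U‖ ≤ ‖U‖ :=
  (H1.norm_d_le _).trans (WithLp.norm_fst_le _ U.1)

lemma norm_dd_le {ν : ℝ} (U : H2 ν) : ‖dd ν U‖ ≤ ‖U‖ := WithLp.norm_snd_le _ U.1

end H2

/-- Integration by parts for indefinite integrals. -/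
lemma ibp {a b : ℝ} (hab : a ≤ b) {W Z : ℝ → ℂ} (hW : IntervalIntegrable W volume a b)
    (hZ : IntervalIntegrable Z volume a b) :
    (∫ x in a..b, (∫ t in a..x, W t) * Z x) + (∫ x in a..b, W x * ∫ t in a..x, Z t)
      = (∫ x in a..b, W x) * ∫ x in a..b, Z x := by
  have keyA : ∫ x in a..b, (∫ t in a..x, W t) * Z x = ∫ x in Ioc a b, ∫ t in Ioc a b,
        {p : ℝ × ℝ | p.2 ≤ p.1}.indicator (fun p => W p.2 * Z p.1) (x, t) := by
    rw [intervalIntegral.integral_of_le hab]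
    refine setIntegral_congr_fun measurableSet_Ioc fun x hx => ?_
    rw [← intervalIntegral.integral_mul_const, intervalIntegral.integral_of_le hx.1.le,
      ← integral_indicator measurableSet_Ioc, ← integral_indicator measurableSet_Ioc]
    congr 1
    ext t
    by_cases h : t ∈ Ioc a x
    · rw [indicator_of_mem h, indicator_of_mem (show t ∈ Ioc a b from ⟨h.1, h.2.trans hx.2⟩), indicator_of_mem]
      exact h.2
    · rw [indicator_of_notMem h]
      by_cases h' : t ∈ Ioc a b
      · rw [indicator_of_mem h', indicator_of_notMem]
        exact fun h2 => h ⟨h'.1, h2⟩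
      · rw [indicator_of_notMem h']
  have keyB : ∫ x in a..b, W x * (∫ t in a..x, Z t) = ∫ x in Ioc a b, ∫ t in Ioc a b,
        {p : ℝ × ℝ | p.2 < p.1}.indicator (fun p => W p.1 * Z p.2) (x, t) := by
    rw [intervalIntegral.integral_of_le hab]
    refine setIntegral_congr_fun measurableSet_Ioc fun x hx => ?_
    rw [← intervalIntegral.integral_const_mul, intervalIntegral.integral_of_le hx.1.le,
      integral_Ioc_eq_integral_Ioo,
      ← integral_indicator measurableSet_Ioo, ← integral_indicator measurableSet_Ioc]
    congr 1
    ext t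
    by_cases h : t ∈ Ioo a x
    · rw [indicator_of_mem h, indicator_of_mem (show t ∈ Ioc a b from ⟨h.1, h.2.le.trans hx.2⟩), indicator_of_mem]
      exact h.2
    · rw [indicator_of_notMem h]
      by_cases h' : t ∈ Ioc a b
      · rw [indicator_of_mem h', indicator_of_notMem]
        exact fun h2 => h ⟨h'.1, h2⟩
      · rw [indicator_of_notMem h']
  rw [keyA, keyB, intervalIntegral.integral_of_le hab, intervalIntegral.integral_of_le hab]
  rw [intervalIntegrable_iff_integrableOn_Ioc_of_le hab] at hW hZ
  unfold IntegrableOn at hW hZ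
  set μ := volume.restrict (Ioc a b) with hμ
  have hp : Integrable (fun p : ℝ × ℝ => W p.1 * Z p.2) (μ.prod μ) := hW.mul_prod hZ
  have hp' : Integrable (fun p : ℝ × ℝ => W p.2 * Z p.1) (μ.prod μ) := hp.swap
  have i1 := hp'.indicator (s := {p : ℝ × ℝ | p.2 ≤ p.1})
      (measurableSet_le measurable_snd measurable_fst)
  have i2 := hp.indicator (s := {p : ℝ × ℝ | p.2 < p.1})
      (measurableSet_lt measurable_snd measurable_fst)
  rw [← integral_prod _ i1, ← integral_prod _ i2, ← integral_prod_swap]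
  refine (integral_add i1.swap i2).symm.trans ?_
  rw [← integral_prod_mul]
  refine integral_congr_ae (ae_of_all _ fun p => ?_)
  by_cases h : p.2 < p.1
  · have : ¬ p.1 ≤ p.2 := not_le.2 h
    simp [indicator, h, this]
  · have : p.1 ≤ p.2 := not_lt.1 h
    simp [indicator, h, this]

set_option maxHeartbeats 1000000 in
/-- du Bois-Reymond lemma. -/
lemma exists_const_of_weak_deriv_zero {h : ℝ → ℂ} (hh : LocallyIntegrableOn h (Ioi (0:ℝ)))
    (h0 : ∀ ψ : ℝ → ℂ, IsTestFunction ψ → ∫ x in Ioi (0:ℝ), h x * deriv ψ x = 0) :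
    ∃ c : ℂ, ∀ᵐ x, x ∈ Ioi (0:ℝ) → h x = c := by
  let ρ : ContDiffBump (2:ℝ) := ⟨1/2, 1, by norm_num, by norm_num⟩
  set r : ℝ → ℝ := ρ.normed volume with hr
  have hr1 : ∫ x, r x = 1 := ρ.integral_normed
  have hrc : ContDiff ℝ ∞ r := ρ.contDiff_normed
  have hrs : HasCompactSupport r := ρ.hasCompactSupport_normed
  have hrt : tsupport r ⊆ Ioi (0:ℝ) := by
    rw [hr, ρ.tsupport_normed_eq]
    intro x hx
    have := Metric.mem_closedBall.1 hx
    rw [Real.dist_eq, abs_le] at this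
    have h1 : ρ.rOut = 1 := rfl
    rw [h1] at this
    simp only [mem_Ioi]; linarith
  have hint : ∀ g : ℝ → ℝ, Continuous g → HasCompactSupport g → tsupport g ⊆ Ioi (0:ℝ) →
      IntegrableOn (fun x => h x * (g x : ℂ)) (Ioi (0:ℝ)) := by
    intro g hg hgc hgs
    have : Integrable (fun x => g x • h x) (volume.restrict (Ioi 0)) := by
      rw [← IntegrableOn, integrableOn_iff_integrable_of_support_subset]
      · rw [← integrableOn_iff_integrable_of_support_subset (s := tsupport g)]
        · exact (hh.integrableOn_compact_subset hgs hgc).continuousOn_smul hg.continuousOn hgc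
        · exact fun x hx => subset_tsupport g fun h => hx (by simp [h])
      · exact fun x hx => hgs (subset_tsupport g fun h => hx (by simp [h]))
    refine this.congr (ae_of_all _ fun x => ?_)
    simp [mul_comm]
  set c : ℂ := ∫ x in Ioi (0:ℝ), h x * (r x : ℂ) with hc
  refine ⟨c, ?_⟩
  have hcl : LocallyIntegrableOn (fun x => h x - c) (Ioi (0:ℝ)) :=
    hh.sub (locallyIntegrableOn_const c)
  have := isOpen_Ioi.ae_eq_zero_of_integral_contDiff_smul_eq_zero (U := Ioi (0:ℝ)) hcl ?_
  · filter_upwards [this] with x hx hx0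
    exact sub_eq_zero.1 (hx hx0)
  intro g hg hgc hgs
  set m : ℝ := ∫ x, g x with hm
  set k : ℝ → ℝ := fun x => g x - m * r x with hk
  have hkc : ContDiff ℝ ∞ k := hg.sub (contDiff_const.mul hrc)
  have hkcs : HasCompactSupport k := hgc.sub (hrs.mul_left (f := fun _ => m))
  have hks : tsupport k ⊆ Ioi (0:ℝ) := by
    have : Function.support k ⊆ tsupport g ∪ tsupport r := by
      intro x hx
      by_contra hn
      rw [mem_union, not_or] at hn
      exact hx (by simp [hk, image_eq_zero_of_notMem_tsupport hn.1,
        image_eq_zero_of_notMem_tsupport hn.2])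
    exact (closure_minimal this ((isClosed_tsupport g).union (isClosed_tsupport r))).trans
      (union_subset hgs hrt)
  have hki : ∫ x, k x = 0 := by
    rw [hk, integral_sub (hg.continuous.integrable_of_hasCompactSupport hgc)
      ((hrc.continuous.integrable_of_hasCompactSupport hrs).const_mul m), integral_const_mul, hr1]
    simp [hm]
  obtain ⟨a, ha, b, hab⟩ : ∃ a > 0, ∃ b, tsupport k ⊆ Icc a b := by
    rcases (tsupport k).eq_empty_or_nonempty with he | hne
    · exact ⟨1, one_pos, 1, by simp [he]⟩
    · obtain ⟨a, ha, ha'⟩ := hkcs.isCompact.exists_isLeast hne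
      obtain ⟨b, hb, hb'⟩ := hkcs.isCompact.exists_isGreatest hne
      exact ⟨a, hks ha, b, fun x hx => ⟨ha' hx, hb' hx⟩⟩
  have hk0 : ∀ x, x ∉ Icc a b → k x = 0 := fun x hx =>
    image_eq_zero_of_notMem_tsupport fun h => hx (hab h)
  set K : ℝ → ℝ := fun x => ∫ t in (0:ℝ)..x, k t with hK
  have hKd : ∀ x, HasDerivAt K (k x) x := fun x => hkc.continuous.integral_hasStrictDerivAt 0 x |>.hasDerivAt
  have hKd' : deriv K = k := funext fun x => (hKd x).deriv
  have hKc : ContDiff ℝ ∞ K := by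
    rw [contDiff_infty_iff_deriv, hKd']
    exact ⟨fun x => (hKd x).differentiableAt, hkc⟩
  have hK0 : ∀ x, x ∉ Icc a b → K x = 0 := by
    intro x hx
    rcases lt_or_ge x a with hxa | hxa
    · simp only [hK]
      rw [intervalIntegral.integral_congr (g := fun _ => (0:ℝ)), intervalIntegral.integral_zero]
      intro t ht
      refine hk0 t fun h => ?_
      have := ht.2
      rcases le_total 0 x with h0 | h0
      · rw [sup_of_le_right h0] at this; linarith [h.1]
      · rw [sup_of_le_left h0] at this; linarith [h.1]
    · have hxb : b < x := by
        by_contra hn; exact hx ⟨hxa, not_lt.1 hn⟩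
      have : K x = ∫ t, k t := by
        simp only [hK]
        rw [intervalIntegral.integral_of_le (ha.le.trans hxa), ← integral_indicator measurableSet_Ioc]
        congr 1; ext t
        by_cases ht : t ∈ Ioc 0 x
        · rw [indicator_of_mem ht]
        · rw [indicator_of_notMem ht, hk0]
          exact fun h => ht ⟨ha.trans_le h.1, h.2.trans hxb.le⟩
      rw [this, hki]
  have hKs : tsupport (fun x => (K x : ℂ)) ⊆ Icc a b := by
    refine closure_minimal (fun x hx => ?_) isClosed_Icc
    by_contra hn
    exact hx (by simp [hK0 x hn])
  have htest : IsTestFunction (fun x => (K x : ℂ)) :=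
    ⟨Complex.ofRealCLM.contDiff.comp hKc,
      isCompact_Icc.of_isClosed_subset (isClosed_tsupport _) hKs,
      fun x hx => ha.trans_le (hKs hx).1⟩
  have hz := h0 _ htest
  have hdz : ∀ x, deriv (fun x => (K x : ℂ)) x = (k x : ℂ) := fun x => (hKd x).ofReal_comp.deriv
  simp only [hdz] at hz
  have I1 := hint r hrc.continuous hrs hrt
  have I2 := hint k hkc.continuous hkcs hks
  have e1 : ∫ x in Ioi (0:ℝ), h x * (g x : ℂ) = m * c := by
    have : ∀ x, h x * (g x : ℂ) = h x * (k x : ℂ) + m * (h x * (r x : ℂ)) := by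
      intro x; simp only [hk]; push_cast; ring
    simp only [this]
    rw [integral_add I2 (I1.const_mul _), hz, integral_const_mul, zero_add]
  have e2 : ∫ x in Ioi (0:ℝ), c * (g x : ℂ) = m * c := by
    rw [integral_const_mul, setIntegral_eq_integral_of_forall_compl_eq_zero, integral_complex_ofReal, mul_comm]
    intro x hx
    rw [image_eq_zero_of_notMem_tsupport fun h => hx (hgs h), Complex.ofReal_zero]
  rw [← setIntegral_eq_integral_of_forall_compl_eq_zero (s := Ioi (0:ℝ))]
  · have : ∀ x, g x • (h x - c) = h x * (g x : ℂ) - c * (g x : ℂ) := by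
      intro x; rw [Complex.real_smul]; ring
    simp only [this]
    rw [integral_sub (hint g hg.continuous hgc hgs), e1, e2, sub_self]
    exact ((Complex.continuous_ofReal.comp hg.continuous).integrable_of_hasCompactSupport
      (hgc.comp_left Complex.ofReal_zero)).integrableOn.const_mul c
  · intro x hx
    rw [image_eq_zero_of_notMem_tsupport fun h => hx (hgs h), zero_smul]


lemma L2.integrableOn_compact (u : L2) {K : Set ℝ} (hK : IsCompact K) (hKs : K ⊆ Ioi (0:ℝ)) :
    IntegrableOn u K := by
  have h1 : MemLp u 2 (volume.restrict K) :=
    (Lp.memLp u).mono_measure (Measure.restrict_mono hKs le_rfl)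
  have : IsFiniteMeasure (volume.restrict K) := ⟨by simpa using hK.measure_lt_top⟩
  exact h1.integrable (by norm_num)

lemma rpow_continuousOn (κ : ℝ) : ContinuousOn (fun x : ℝ => ((x ^ κ : ℝ) : ℂ)) (Ioi (0:ℝ)) :=
  fun x hx => (Complex.continuous_ofReal.continuousAt.comp
    (Real.continuousAt_rpow_const x κ (Or.inl (ne_of_gt hx)))).continuousWithinAt

lemma L2.rpow_mul_integrableOn (u : L2) (κ : ℝ) {K : Set ℝ} (hK : IsCompact K)
    (hKs : K ⊆ Ioi (0:ℝ)) : IntegrableOn (fun x => ((x ^ κ : ℝ) : ℂ) * u x) K :=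
  (u.integrableOn_compact hK hKs).continuousOn_mul ((rpow_continuousOn κ).mono hKs) hK

lemma L2.rpow_mul_intervalIntegrable (u : L2) (κ : ℝ) {a b : ℝ} (ha : 0 < a) (hb : 0 < b) :
    IntervalIntegrable (fun x => ((x ^ κ : ℝ) : ℂ) * u x) volume a b := by
  rw [intervalIntegrable_iff']
  exact u.rpow_mul_integrableOn κ isCompact_uIcc fun x hx => (lt_min ha hb).trans_le hx.1

lemma L2.rpow_mul_locallyIntegrableOn (u : L2) (κ : ℝ) :
    LocallyIntegrableOn (fun x => ((x ^ κ : ℝ) : ℂ) * u x) (Ioi (0:ℝ)) := by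
  rw [locallyIntegrableOn_iff isOpen_Ioi.isLocallyClosed]
  exact fun K hK hKc => u.rpow_mul_integrableOn κ hKc hK

lemma L2.primitive_continuousOn (u : L2) (κ : ℝ) :
    ContinuousOn (fun y : ℝ => ∫ x in (1:ℝ)..y, ((x ^ κ : ℝ) : ℂ) * u x) (Ioi (0:ℝ)) := by
  intro y hy
  have hy' : (0:ℝ) < y := hy
  have h := intervalIntegral.continuousOn_primitive_interval' (a := 1)
    (b₁ := min 1 (y / 2)) (b₂ := max 1 (y + 1))
    (u.rpow_mul_intervalIntegrable κ (lt_min one_pos (by linarith)) (lt_max_of_lt_left one_pos))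
    (by rw [uIcc_of_le ((min_le_left _ _).trans (le_max_left _ _))]
        exact ⟨min_le_left _ _, le_max_left _ _⟩)
  rw [uIcc_of_le ((min_le_left _ _).trans (le_max_left _ _))] at h
  refine (h.continuousAt (Icc_mem_nhds ?_ ?_)).continuousWithinAt
  · exact (min_le_right _ _).trans_lt (by linarith)
  · exact lt_of_lt_of_le (by linarith) (le_max_right _ _)

lemma IsTestFunction.exists_Ioo {φ : ℝ → ℂ} (h : IsTestFunction φ) :
    ∃ a b : ℝ, 0 < a ∧ a < b ∧ ∀ x, x ∉ Ioo a b → φ x = 0 := by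
  rcases (tsupport φ).eq_empty_or_nonempty with he | hne
  · refine ⟨1, 2, by norm_num, by norm_num, fun x _ => image_eq_zero_of_notMem_tsupport ?_⟩
    simp [he]
  · obtain ⟨a, ha, ha'⟩ := h.2.1.isCompact.exists_isLeast hne
    obtain ⟨b, hb, hb'⟩ := h.2.1.isCompact.exists_isGreatest hne
    have h0 : 0 < a := h.2.2 ha
    have hab : a ≤ b := ha' hb
    refine ⟨a / 2, b + 1, by linarith, by linarith, fun x hx => ?_⟩
    refine image_eq_zero_of_notMem_tsupport fun hx' => hx ⟨?_, ?_⟩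
    · have : a ≤ x := ha' hx'
      linarith
    · have : x ≤ b := hb' hx'
      linarith

lemma IsTestFunction.rpow_mul {φ : ℝ → ℂ} (h : IsTestFunction φ) (κ : ℝ) :
    IsTestFunction (fun x => ((x ^ κ : ℝ) : ℂ) * φ x) := by
  refine ⟨?_, h.2.1.mul_left, (tsupport_mul_subset_right).trans h.2.2⟩
  rw [contDiff_iff_contDiffAt]
  intro x
  by_cases hx : x = 0
  · subst hx
    refine (contDiffAt_const (c := (0:ℂ))).congr_of_eventuallyEq ?_
    filter_upwards [h.zero_near] with y hy
    simp [hy]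
  · exact (Complex.ofRealCLM.contDiff.contDiffAt.comp x
      (Real.contDiffAt_rpow_const_of_ne hx)).mul h.1.contDiffAt

lemma hasDerivAt_rpow_mul {φ : ℝ → ℂ} {φ' : ℂ} (κ : ℝ) {x : ℝ} (hx : 0 < x)
    (h : HasDerivAt φ φ' x) :
    HasDerivAt (fun x : ℝ => ((x ^ κ : ℝ) : ℂ) * φ x)
      (((x ^ κ : ℝ) : ℂ) * (φ' + ((κ / x : ℝ) : ℂ) * φ x)) x := by
  have h1 : HasDerivAt (fun x : ℝ => ((x ^ κ : ℝ) : ℂ)) ((κ * x ^ (κ - 1) : ℝ) : ℂ) x :=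
    (Real.hasDerivAt_rpow_const (Or.inl hx.ne')).ofReal_comp
  refine (h1.mul h).congr_deriv ?_
  rw [Real.rpow_sub_one hx.ne']
  push_cast
  ring

/-- An `L²` function with `L²` weak derivative `∂_ν` is `x ^ (1/2 - ν)` times an indefinite
integral. -/
lemma exists_rep {ν : ℝ} {u w : L2} (h : IsWeakD ν u w) :
    ∃ g : ℝ → ℂ, ContinuousOn g (Ioi (0:ℝ)) ∧
      (∀ a b : ℝ, 0 < a → 0 < b → g b - g a = ∫ x in a..b, ((x ^ (ν - 1 / 2) : ℝ) : ℂ) * w x) ∧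
      ∀ᵐ x, x ∈ Ioi (0:ℝ) → u x = ((x ^ (1 / 2 - ν) : ℝ) : ℂ) * g x := by
  set κ : ℝ := ν - 1 / 2 with hκ
  set W : ℝ → ℂ := fun x => ((x ^ κ : ℝ) : ℂ) * w x with hW
  set G : ℝ → ℂ := fun y => ∫ x in (1:ℝ)..y, W x with hG
  have hGc : ContinuousOn G (Ioi (0:ℝ)) := w.primitive_continuousOn κ
  have hGl : LocallyIntegrableOn G (Ioi (0:ℝ)) := hGc.locallyIntegrableOn measurableSet_Ioi
  have hGd : ∀ a b : ℝ, 0 < a → 0 < b → G b - G a = ∫ x in a..b, W x := fun a b ha hb =>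
    intervalIntegral.integral_interval_sub_left (w.rpow_mul_intervalIntegrable κ one_pos hb)
      (w.rpow_mul_intervalIntegrable κ one_pos ha)
  have hF := u.rpow_mul_locallyIntegrableOn κ
  obtain ⟨c, hc⟩ := exists_const_of_weak_deriv_zero (hF.sub hGl) (by
    intro ψ hψ
    obtain ⟨a, b, ha, hab, h0⟩ := hψ.exists_Ioo
    have hb : 0 < b := ha.trans hab
    have hψa : ψ a = 0 := h0 a (by simp)
    have hψb : ψ b = 0 := h0 b (by simp)
    have hd : ∀ x, HasDerivAt ψ (deriv ψ x) x := fun x =>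
      (hψ.1.differentiable (by simp) x).hasDerivAt
    have hdc : Continuous (deriv ψ) := hψ.1.continuous_deriv (by simp)
    have hd0 : ∀ x, x ∉ Ioc a b → deriv ψ x = 0 := by
      intro x hx
      rcases lt_or_ge b x with hbx | hbx
      · have : ψ =ᶠ[𝓝 x] fun _ => 0 := by
          filter_upwards [Ioi_mem_nhds hbx] with y hy
          exact h0 y fun h => lt_asymm h.2 hy
        rw [this.deriv_eq, deriv_const]
      · have hxa : x ≤ a := by
          by_contra hn; exact hx ⟨not_le.1 hn, hbx⟩
        have hs := (hd x).hasDerivWithinAt (s := Iic x)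
        have : HasDerivWithinAt ψ 0 (Iic x) x :=
          (hasDerivWithinAt_const x (Iic x) (0:ℂ)).congr
            (fun y hy => h0 y fun h => absurd (h.1.trans_le hy) (not_lt.2 hxa))
            (h0 x fun h => absurd h.1 (not_lt.2 hxa))
        exact (uniqueDiffWithinAt_Iic x).eq_deriv _ hs this
    have hsub : Ioc a b ⊆ Ioi (0:ℝ) := fun x hx => ha.trans hx.1
    -- pairing of `x ^ κ * u`
    have e1 : ∫ x in Ioi (0:ℝ), ((x ^ κ : ℝ) : ℂ) * u x * deriv ψ x
        = - ∫ x in Ioi (0:ℝ), W x * ψ x := by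
      have := h _ (hψ.rpow_mul κ)
      rw [← neg_eq_iff_eq_neg, ← integral_neg]
      calc _ = _ := ?_
        _ = _ := this
        _ = _ := ?_
      · refine setIntegral_congr_fun measurableSet_Ioi fun x hx => ?_
        have hx' : (0:ℝ) < x := hx
        simp only [bdStar]
        rw [(hasDerivAt_rpow_mul κ hx' (hd x)).deriv, ← hκ]
        ring
      · refine setIntegral_congr_fun measurableSet_Ioi fun x hx => ?_
        simp only [hW]; ring
    have hrestr : ∀ f : ℝ → ℂ, (∀ x, x ∉ Ioc a b → f x = 0) →
        ∫ x in Ioi (0:ℝ), f x = ∫ x in a..b, f x := by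
      intro f hf
      rw [intervalIntegral.integral_of_le hab.le]
      exact setIntegral_eq_of_subset_of_forall_sdiff_eq_zero measurableSet_Ioi hsub
        fun x hx => hf x hx.2
    have hWi : IntervalIntegrable W volume a b := w.rpow_mul_intervalIntegrable κ ha hb
    have hdi : IntervalIntegrable (deriv ψ) volume a b := hdc.intervalIntegrable _ _
    have hprim : ∀ y, ∫ t in a..y, deriv ψ t = ψ y := fun y => by
      rw [intervalIntegral.integral_deriv_eq_sub (fun x _ => hψ.1.differentiable (by simp) x)
        (hdc.intervalIntegrable _ _), hψa, sub_zero]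
    have e2 : ∫ x in Ioi (0:ℝ), G x * deriv ψ x = - ∫ x in Ioi (0:ℝ), W x * ψ x := by
      rw [hrestr _ fun x hx => by rw [hd0 x hx, mul_zero],
        hrestr _ fun x hx => by rw [h0 x fun h => hx ⟨h.1, h.2.le⟩, mul_zero]]
      have := ibp hab.le hWi hdi
      simp only [hprim, hψb, mul_zero] at this
      rw [← eq_neg_iff_add_eq_zero] at this
      rw [← this]
      have hcon : ∫ x in a..b, G a * deriv ψ x = 0 := by
        rw [intervalIntegral.integral_const_mul, hprim, hψb, mul_zero]
      rw [← sub_eq_zero, ← intervalIntegral.integral_sub, ← hcon]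
      · refine intervalIntegral.integral_congr fun x hx => ?_
        rw [uIcc_of_le hab.le] at hx
        rw [← hGd a x ha (ha.trans_le hx.1)]
        ring
      · refine hdi.continuousOn_mul (hGc.mono fun x hx => ?_)
        rw [uIcc_of_le hab.le] at hx
        exact ha.trans_le hx.1
      · refine hdi.continuousOn_mul ?_
        have := intervalIntegral.continuousOn_primitive_interval' hWi (left_mem_uIcc)
        exact this
    have hKc : IsCompact (Icc a b) := isCompact_Icc
    have hKs : Icc a b ⊆ Ioi (0:ℝ) := fun x hx => ha.trans_le hx.1
    have hint : ∀ f : ℝ → ℂ, LocallyIntegrableOn f (Ioi (0:ℝ)) →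
        IntegrableOn (fun x => f x * deriv ψ x) (Ioi (0:ℝ)) := by
      intro f hf
      have h1 : IntegrableOn (fun x => f x * deriv ψ x) (Ioc a b) :=
        ((hf.integrableOn_compact_subset hKs hKc).mul_continuousOn hdc.continuousOn hKc).mono_set
          Ioc_subset_Icc_self
      refine h1.of_forall_sdiff_eq_zero measurableSet_Ioi fun x hx => ?_
      rw [hd0 x hx.2, mul_zero]
    simp only [Pi.sub_apply, sub_mul]
    rw [integral_sub (hint _ hF) (hint _ hGl), e1, e2, sub_self])
  refine ⟨fun y => G y + c, hGc.add continuousOn_const, fun a b ha hb => ?_, ?_⟩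
  · rw [add_sub_add_right_eq_sub, hGd a b ha hb]
  · filter_upwards [hc] with x hx hx0
    have := hx hx0
    simp only [Pi.sub_apply] at this
    rw [add_comm, ← this, sub_add_cancel, ← mul_assoc, ← Complex.ofReal_mul,
      ← Real.rpow_add hx0]
    simp [hκ]


lemma near_zero_bound {κ : ℝ} (hκ : -(1 / 2) < κ) : ∃ K : ℝ, 0 ≤ K ∧ ∀ u : L2,
    IntegrableOn (fun x => ((x ^ κ : ℝ) : ℂ) * u x) (Ioc 0 1) ∧
      ∫ x in Ioc (0:ℝ) 1, ‖((x ^ κ : ℝ) : ℂ) * u x‖ ≤ K * ‖u‖ := by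
  set μ : Measure ℝ := volume.restrict (Ioc 0 1) with hμ
  have hm : MemLp (fun x : ℝ => ((x ^ κ : ℝ) : ℂ)) 2 μ := by
    rw [memLp_two_iff_integrable_sq_norm]
    · have h1 : IntegrableOn (fun x : ℝ => x ^ (2 * κ)) (Ioc 0 1) := by
        rw [← intervalIntegrable_iff_integrableOn_Ioc_of_le zero_le_one]
        exact intervalIntegral.intervalIntegrable_rpow' (by linarith)
      refine h1.congr_fun (fun x hx => ?_) measurableSet_Ioc
      simp only
      rw [Complex.norm_real, Real.norm_of_nonneg (Real.rpow_nonneg hx.1.le _), ← Real.rpow_natCast,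
        ← Real.rpow_mul hx.1.le, mul_comm 2 κ]
      norm_num
    · exact (Complex.measurable_ofReal.comp
        (measurable_id.pow_const κ)).aestronglyMeasurable
  refine ⟨(eLpNorm (fun x : ℝ => ((x ^ κ : ℝ) : ℂ)) 2 μ).toReal, ENNReal.toReal_nonneg,
    fun u => ?_⟩
  have hle : μ ≤ volume.restrict (Ioi (0:ℝ)) :=
    Measure.restrict_mono (fun x hx => hx.1) le_rfl
  have hu : MemLp u 2 μ := (Lp.memLp u).mono_measure hle
  have hi : Integrable (fun x => ((x ^ κ : ℝ) : ℂ) * u x) μ := hm.integrable_mul hu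
  refine ⟨hi, ?_⟩
  rw [integral_norm_eq_lintegral_enorm hi.aestronglyMeasurable, ← eLpNorm_one_eq_lintegral_enorm,
    Lp.norm_def, ← ENNReal.toReal_mul]
  refine ENNReal.toReal_mono (ENNReal.mul_ne_top hm.eLpNorm_ne_top (Lp.eLpNorm_ne_top u)) ?_
  calc _ ≤ eLpNorm (fun x : ℝ => ((x ^ κ : ℝ) : ℂ)) 2 μ * eLpNorm u 2 μ :=
        eLpNorm_smul_le_mul_eLpNorm hu.aestronglyMeasurable hm.aestronglyMeasurable
    _ ≤ _ := by gcongr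

/-- `x ^ κ * f x → c` as `x → 0+`. -/
def HasWeightedTrace (κ : ℝ) (f : ℝ → ℂ) (c : ℂ) : Prop :=
  Tendsto (fun x : ℝ => ((x ^ κ : ℝ) : ℂ) * f x) (𝓝[>] 0) (𝓝 c)

/-- The continuous representative `f` of `u` satisfies `x ^ κ * f x → c` as `x → 0+`. -/
def L2.HasTrace (κ : ℝ) (u : L2) (c : ℂ) : Prop :=
  ∃ f : ℝ → ℂ, ContinuousOn f (Ioi 0) ∧ (∀ᵐ x ∂volume.restrict (Ioi (0 : ℝ)), u x = f x) ∧
    HasWeightedTrace κ f c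

lemma L2.HasTrace.unique {κ : ℝ} {u : L2} {c c' : ℂ} (h : u.HasTrace κ c)
    (h' : u.HasTrace κ c') : c = c' := by
  obtain ⟨f, hf, huf, hc⟩ := h
  obtain ⟨g, hg, hug, hc'⟩ := h'
  have : EqOn f g (Ioi 0) := Measure.eqOn_open_of_ae_eq
    (by filter_upwards [huf, hug] with x h1 h2; rw [← h1, ← h2]) isOpen_Ioi hf hg
  refine tendsto_nhds_unique hc (hc'.congr' ?_)
  filter_upwards [self_mem_nhdsWithin] with x hx
  rw [this hx]

lemma L2.HasTrace.add {κ : ℝ} {u v : L2} {c c' : ℂ} (h : u.HasTrace κ c)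
    (h' : v.HasTrace κ c') : (u + v).HasTrace κ (c + c') := by
  obtain ⟨f, hf, huf, hc⟩ := h
  obtain ⟨g, hg, hug, hc'⟩ := h'
  refine ⟨fun x => f x + g x, hf.add hg, ?_, ?_⟩
  · filter_upwards [huf, hug, Lp.coeFn_add u v] with x h1 h2 h3
    rw [h3, Pi.add_apply, h1, h2]
  · simpa only [HasWeightedTrace, mul_add] using Tendsto.add hc hc'

lemma L2.HasTrace.smul {κ : ℝ} {u : L2} {c : ℂ} (k : ℂ) (h : u.HasTrace κ c) :
    (k • u).HasTrace κ (k * c) := by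
  obtain ⟨f, hf, huf, hc⟩ := h
  refine ⟨fun x => k * f x, continuousOn_const.mul hf, ?_, ?_⟩
  · filter_upwards [huf, Lp.coeFn_smul k u] with x h1 h3
    rw [h3, Pi.smul_apply, h1, smul_eq_mul]
  · simpa only [HasWeightedTrace, mul_left_comm] using Tendsto.const_mul k hc

/-- Existence of the trace `γ₋`, with a bound. -/
lemma exists_gammaMinus {ν : ℝ} (hν : 0 < ν) : ∃ K : ℝ, 0 ≤ K ∧ ∀ u w : L2, IsWeakD ν u w →
    ∃ c : ℂ, u.HasTrace (ν - 1 / 2) c ∧ ‖c‖ ≤ K * (‖u‖ + ‖w‖) := by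
  obtain ⟨K, hK, hb⟩ := near_zero_bound (κ := ν - 1 / 2) (by linarith)
  refine ⟨K, hK, fun u w h => ?_⟩
  obtain ⟨g, hgc, hgd, hug⟩ := exists_rep h
  obtain ⟨hui, hun⟩ := hb u
  obtain ⟨hwi, hwn⟩ := hb w
  set W : ℝ → ℂ := fun x => ((x ^ (ν - 1 / 2) : ℝ) : ℂ) * w x with hW
  set c : ℂ := g 1 + ∫ x in (1:ℝ)..0, W x with hc
  have hWi : IntervalIntegrable W volume 0 1 :=
    (intervalIntegrable_iff_integrableOn_Ioc_of_le zero_le_one).2 hwi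
  have hlim : Tendsto g (𝓝[>] 0) (𝓝 c) := by
    have h1 := intervalIntegral.continuousOn_primitive_interval' (a := 1) hWi right_mem_uIcc
    rw [uIcc_of_le zero_le_one] at h1
    have h2 : Tendsto (fun b => ∫ x in (1:ℝ)..b, W x) (𝓝[>] 0) (𝓝 (∫ x in (1:ℝ)..0, W x)) :=
      (h1 0 (by simp)).mono_left (by
        rw [← nhdsWithin_Ioc_eq_nhdsGT (zero_lt_one' ℝ)]
        exact nhdsWithin_mono _ Ioc_subset_Icc_self)
    refine (h2.const_add (g 1)).congr' ?_
    filter_upwards [self_mem_nhdsWithin] with x hx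
    rw [← hgd 1 x one_pos hx]; ring
  have hbd : ∀ x ∈ Ioc (0:ℝ) 1, ‖c‖ ≤ ‖g x‖ + ∫ x in Ioc (0:ℝ) 1, ‖W x‖ := by
    intro x hx
    have h1 : ‖c - g x‖ ≤ ∫ x in Ioc (0:ℝ) 1, ‖W x‖ := by
      refine le_of_tendsto (hlim.sub_const (g x)).norm ?_
      filter_upwards [Ioc_mem_nhdsGT (zero_lt_one' ℝ)] with y hy
      rw [hgd x y hx.1 hy.1]
      refine intervalIntegral.norm_integral_le_integral_norm_uIoc.trans ?_
      refine setIntegral_mono_set hwi.norm (ae_of_all _ fun _ => norm_nonneg _) ?_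
      refine LE.le.eventuallyLE fun z hz => ?_
      rw [mem_uIoc] at hz
      rcases hz with hz | hz
      · exact ⟨hx.1.trans hz.1, hz.2.trans hy.2⟩
      · exact ⟨hy.1.trans hz.1, hz.2.trans hx.2⟩
    calc ‖c‖ = ‖g x + (c - g x)‖ := by congr 1; ring
      _ ≤ _ := (norm_add_le _ _).trans (by gcongr)
  refine ⟨c, ⟨fun x => ((x ^ (1 / 2 - ν) : ℝ) : ℂ) * g x, (rpow_continuousOn _).mul hgc,
    (ae_restrict_iff' measurableSet_Ioi).2 hug, ?_⟩, ?_⟩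
  · refine hlim.congr' ?_
    filter_upwards [self_mem_nhdsWithin] with x hx
    rw [← mul_assoc, ← Complex.ofReal_mul, ← Real.rpow_add hx]
    simp
  · have h1 : ∫ x in Ioc (0:ℝ) 1, ‖c‖ ≤ ∫ x in Ioc (0:ℝ) 1,
        (‖((x ^ (ν - 1 / 2) : ℝ) : ℂ) * u x‖ + ∫ x in Ioc (0:ℝ) 1, ‖W x‖) := by
      refine setIntegral_mono_on_ae (integrable_const (μ := volume.restrict (Ioc (0:ℝ) 1)) _)
        (hui.norm.add (integrable_const (μ := volume.restrict (Ioc (0:ℝ) 1)) _)) measurableSet_Ioc ?_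
      filter_upwards [hug] with x hx hx1
      refine (hbd x hx1).trans_eq ?_
      rw [hx hx1.1, ← mul_assoc, ← Complex.ofReal_mul, ← Real.rpow_add hx1.1]
      simp
    rw [integral_add hui.norm (integrable_const _)] at h1
    simp only [integral_const, measureReal_restrict_apply_univ, Real.volume_real_Ioc, sub_zero,
      zero_le_one, sup_of_le_left, smul_eq_mul, one_mul] at h1
    calc ‖c‖ ≤ _ := h1
      _ ≤ K * ‖u‖ + K * ‖w‖ := add_le_add hun hwn
      _ = _ := by ring


lemma IsWeakDStar.isWeakD {ν : ℝ} {w z : L2} (h : IsWeakDStar ν w z) :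
    IsWeakD (1 - ν) w (-z : L2) := by
  intro φ hφ
  have e : ∀ x, bdStar (1 - ν) φ x = -bd ν φ x := by
    intro x
    have : (1 - ν - 1 / 2) / x = -((ν - 1 / 2) / x) := by ring
    simp only [bdStar, bd, this]
    push_cast
    ring
  have h1 : ∫ x in Ioi (0 : ℝ), (-z : L2) x * φ x = -∫ x in Ioi (0 : ℝ), z x * φ x := by
    have := pair_smul (-1) z φ
    simpa using this
  rw [h1, ← h φ hφ, ← integral_neg]
  simp only [e, mul_neg]

/-- The functional sending `U` to the limit of `x ^ κ * (A U) x` as `x → 0+`. -/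
def traceOf {X : Type} [NormedAddCommGroup X] [NormedSpace ℂ X] (κ : ℝ) (A : X →L[ℂ] L2)
    (h : ∃ K : ℝ, ∀ U : X, ∃ c : ℂ, (A U).HasTrace κ c ∧ ‖c‖ ≤ K * ‖U‖) : X →L[ℂ] ℂ :=
  have ex : ∀ U : X, ∃ c : ℂ, (A U).HasTrace κ c := fun U =>
    let ⟨_, hK⟩ := h
    let ⟨c, hc, _⟩ := hK U
    ⟨c, hc⟩
  LinearMap.mkContinuousOfExistsBound
    { toFun := fun U => Classical.choose (ex U)
      map_add' := fun U V => by
        refine (Classical.choose_spec (ex (U + V))).unique ?_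
        rw [map_add]
        exact (Classical.choose_spec (ex U)).add (Classical.choose_spec (ex V))
      map_smul' := fun k U => by
        refine (Classical.choose_spec (ex (k • U))).unique ?_
        rw [map_smul]
        exact (Classical.choose_spec (ex U)).smul k }
    (by
      obtain ⟨K, hK⟩ := h
      refine ⟨K, fun U => ?_⟩
      obtain ⟨c, hc, hb⟩ := hK U
      have h1 : Classical.choose (ex U) = c := (Classical.choose_spec (ex U)).unique hc
      simpa only [LinearMap.coe_mk, AddHom.coe_mk, h1] using hb)

lemma traceOf_spec {X : Type} [NormedAddCommGroup X] [NormedSpace ℂ X] (κ : ℝ) (A : X →L[ℂ] L2)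
    (h : ∃ K : ℝ, ∀ U : X, ∃ c : ℂ, (A U).HasTrace κ c ∧ ‖c‖ ≤ K * ‖U‖) (U : X) :
    (A U).HasTrace κ (traceOf κ A h U) :=
  Classical.choose_spec (p := fun c => (A U).HasTrace κ c) _

lemma H1.exists_trace {ν : ℝ} (hν : 0 < ν) : ∃ K : ℝ, ∀ U : H1 ν,
    ∃ c : ℂ, (H1.incl ν U).HasTrace (ν - 1 / 2) c ∧ ‖c‖ ≤ K * ‖U‖ := by
  obtain ⟨K, hK, h⟩ := exists_gammaMinus hν
  refine ⟨K * 2, fun U => ?_⟩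
  obtain ⟨c, hc, hb⟩ := h _ _ U.isWeakD
  refine ⟨c, hc, hb.trans ?_⟩
  rw [mul_assoc, two_mul]
  gcongr
  · exact H1.norm_incl_le U
  · exact H1.norm_d_le U

lemma H2.exists_trace {ν : ℝ} (hν : ν < 1) : ∃ K : ℝ, ∀ U : H2 ν,
    ∃ c : ℂ, (H2.d ν U).HasTrace (1 / 2 - ν) c ∧ ‖c‖ ≤ K * ‖U‖ := by
  obtain ⟨K, hK, h⟩ := exists_gammaMinus (ν := 1 - ν) (by linarith)
  refine ⟨K * 2, fun U => ?_⟩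
  obtain ⟨c, hc, hb⟩ := h _ _ U.isWeakDStar.isWeakD
  rw [show 1 - ν - 1 / 2 = 1 / 2 - ν by ring] at hc
  refine ⟨c, hc, hb.trans ?_⟩
  rw [mul_assoc, two_mul, norm_neg]
  gcongr
  · exact H2.norm_d_le U
  · exact H2.norm_dd_le U

/-- The weighted trace `γ₋ u = lim x ^ (ν - 1/2) u` as `x → 0+`, for `u ∈ ℋ¹`. -/
def gammaMinus (ν : ℝ) (hν : 0 < ν) : H1 ν →L[ℂ] ℂ :=
  traceOf (ν - 1 / 2) (H1.incl ν) (H1.exists_trace hν)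

/-- The weighted trace `γ₊ u = lim x ^ (1/2 - ν) ∂_ν u` as `x → 0+`, for `u ∈ ℋ²`. -/
def gammaPlus (ν : ℝ) (hν : ν < 1) : H2 ν →L[ℂ] ℂ :=
  traceOf (1 / 2 - ν) (H2.d ν) (H2.exists_trace hν)

/-- Green's formula
`⟨|D_ν|² u, v⟩ = ⟨D_ν u, D_ν v⟩ + ⟨γ₊ u, γ₋ v⟩` for `u ∈ ℋ²`, `v ∈ ℋ¹`. -/
lemma green {ν : ℝ} (h0 : 0 < ν) (h1 : ν < 1) (U : H2 ν) (V : H1 ν) :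
    inner ℂ (H1.incl ν V) (H2.dd ν U) = inner ℂ (H1.d ν V) (H2.d ν U)
      + gammaPlus ν h1 U * starRingEnd ℂ (gammaMinus ν h0 V) := by
  set v := H1.incl ν V with hv
  set v' := H1.d ν V with hv'
  set w := H2.d ν U with hw
  set z := H2.dd ν U with hz
  have hV : IsWeakD ν v v' := V.isWeakD
  have hU : IsWeakDStar ν w z := U.isWeakDStar
  obtain ⟨g, hgc, hgd, hg⟩ := exists_rep hV
  obtain ⟨h, hhc, hhd, hh⟩ := exists_rep hU.isWeakD
  have hgt : Tendsto g (𝓝[>] 0) (𝓝 (gammaMinus ν h0 V)) := by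
    obtain ⟨f, hf, hvf, hl⟩ := traceOf_spec _ _ (H1.exists_trace h0) V
    have : EqOn f (fun x => ((x ^ (1 / 2 - ν) : ℝ) : ℂ) * g x) (Ioi 0) :=
      Measure.eqOn_open_of_ae_eq (μ := volume)
        (by filter_upwards [hvf, (ae_restrict_iff' measurableSet_Ioi).2 hg] with x h1 h2
            rw [← h1, ← h2]) isOpen_Ioi hf ((rpow_continuousOn _).mul hgc)
    refine hl.congr' ?_
    filter_upwards [self_mem_nhdsWithin] with x hx
    rw [this hx, ← mul_assoc, ← Complex.ofReal_mul, ← Real.rpow_add hx]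
    simp
  have hht : Tendsto h (𝓝[>] 0) (𝓝 (gammaPlus ν h1 U)) := by
    obtain ⟨f, hf, hvf, hl⟩ := traceOf_spec _ _ (H2.exists_trace h1) U
    have : EqOn f (fun x => ((x ^ (1 / 2 - (1 - ν)) : ℝ) : ℂ) * h x) (Ioi 0) :=
      Measure.eqOn_open_of_ae_eq (μ := volume)
        (by filter_upwards [hvf, (ae_restrict_iff' measurableSet_Ioi).2 hh] with x h1 h2
            rw [← h1, ← h2]) isOpen_Ioi hf ((rpow_continuousOn _).mul hhc)
    refine hl.congr' ?_
    filter_upwards [self_mem_nhdsWithin] with x hx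
    rw [this hx, ← mul_assoc, ← Complex.ofReal_mul, ← Real.rpow_add hx]
    ring_nf
    simp
  -- products of `L²` functions
  have hint : ∀ p q : L2, IntegrableOn (fun x => p x * starRingEnd ℂ (q x)) (Ioi (0:ℝ)) :=
    fun p q => (Lp.memLp p).integrable_mul (Lp.memLp q).star
  have hinner : ∀ p q : L2, inner ℂ q p = ∫ x in Ioi (0:ℝ), p x * starRingEnd ℂ (q x) := by
    intro p q
    rw [MeasureTheory.L2.inner_def]
    rfl
  set Φ : ℝ → ℂ := fun x => w x * starRingEnd ℂ (v' x) - z x * starRingEnd ℂ (v x) with hΦ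
  have hΦi : IntegrableOn Φ (Ioi (0:ℝ)) := (hint w v').sub (hint z v)
  have hQ : ∀ a b : ℝ, 0 < a → a ≤ b →
      h b * starRingEnd ℂ (g b) - h a * starRingEnd ℂ (g a) = ∫ x in a..b, Φ x := by
    intro a b ha hab
    have hb : 0 < b := ha.trans_le hab
    have hs : uIcc a b ⊆ Ioi (0:ℝ) := by
      rw [uIcc_of_le hab]; exact fun x hx => ha.trans_le hx.1
    set Wh : ℝ → ℂ := fun x => ((x ^ (1 - ν - 1 / 2) : ℝ) : ℂ) * (-z : L2) x with hWh
    set Wg : ℝ → ℂ := fun x => starRingEnd ℂ (((x ^ (ν - 1 / 2) : ℝ) : ℂ) * v' x) with hWg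
    have iWh : IntervalIntegrable Wh volume a b := L2.rpow_mul_intervalIntegrable _ _ ha hb
    have iWg : IntervalIntegrable Wg volume a b := by
      have := v'.rpow_mul_intervalIntegrable (ν - 1 / 2) ha hb
      rw [intervalIntegrable_iff] at this ⊢
      exact Complex.conjCLE.toContinuousLinearMap.integrable_comp this
    have hhd' : ∀ x, 0 < x → ∫ t in a..x, Wh t = h x - h a := fun x hx => (hhd a x ha hx).symm
    have hgd' : ∀ x, 0 < x → ∫ t in a..x, Wg t = starRingEnd ℂ (g x) - starRingEnd ℂ (g a) := by
      intro x hx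
      rw [← map_sub, hgd a x ha hx]
      simp only [hWg, intervalIntegral]
      rw [integral_conj, integral_conj, map_sub]
    have hgc' : ContinuousOn (fun x => starRingEnd ℂ (g x)) (uIcc a b) :=
      Complex.continuous_conj.comp_continuousOn (hgc.mono hs)
    have key := ibp hab iWh iWg
    have k1 : ∫ x in a..b, (∫ t in a..x, Wh t) * Wg x
        = (∫ x in a..b, h x * Wg x) - h a * ∫ x in a..b, Wg x := by
      rw [← intervalIntegral.integral_const_mul, ← intervalIntegral.integral_sub
        (iWg.continuousOn_mul (hhc.mono hs)) (iWg.const_mul _)]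
      refine intervalIntegral.integral_congr fun x hx => ?_
      simp only [hhd' x (hs hx)]
      ring
    have k2 : ∫ x in a..b, Wh x * (∫ t in a..x, Wg t)
        = (∫ x in a..b, Wh x * starRingEnd ℂ (g x))
          - (∫ x in a..b, Wh x) * starRingEnd ℂ (g a) := by
      rw [← intervalIntegral.integral_mul_const, ← intervalIntegral.integral_sub
        (iWh.mul_continuousOn hgc') (iWh.mul_const _)]
      refine intervalIntegral.integral_congr fun x hx => ?_
      simp only [hgd' x (hs hx)]
      ring
    have k3 : ∫ x in a..b, Φ x
        = (∫ x in a..b, h x * Wg x) + ∫ x in a..b, Wh x * starRingEnd ℂ (g x) := by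
      rw [← intervalIntegral.integral_add (iWg.continuousOn_mul (hhc.mono hs))
        (iWh.mul_continuousOn hgc')]
      refine intervalIntegral.integral_congr_ae ?_
      filter_upwards [hg, hh, (ae_restrict_iff' measurableSet_Ioi).1 (Lp.coeFn_neg z)]
        with x e1 e2 e3 hx
      have hx0 : x ∈ Ioi (0:ℝ) := hs (uIoc_subset_uIcc hx)
      simp only [hΦ, hWh, hWg]
      rw [e3 hx0, e1 hx0, e2 hx0, Pi.neg_apply, show 1 / 2 - (1 - ν) = ν - 1 / 2 by ring,
        show 1 - ν - 1 / 2 = 1 / 2 - ν by ring]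
      simp only [map_mul, Complex.conj_ofReal]
      ring
    rw [k1, k2, hhd' b hb, hgd' b hb] at key
    rw [k3]
    linear_combination -key
  have hae : ∀ᵐ x, x ∈ Ioi (0:ℝ) → h x * starRingEnd ℂ (g x) = w x * starRingEnd ℂ (v x) := by
    filter_upwards [hg, hh] with x h1 h2 hx
    rw [h1 hx, h2 hx, map_mul, Complex.conj_ofReal, mul_mul_mul_comm, ← Complex.ofReal_mul,
      ← Real.rpow_add hx]
    ring_nf
    simp
  have hΦii : ∀ a b : ℝ, 0 ≤ a → 0 ≤ b → IntervalIntegrable Φ volume a b := fun a b ha hb => by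
    rw [intervalIntegrable_iff]
    refine hΦi.mono_set fun x hx => ?_
    exact (le_min ha hb).trans_lt hx.1
  set c : ℂ := gammaPlus ν h1 U * starRingEnd ℂ (gammaMinus ν h0 V) with hc
  set T : ℝ → ℂ := fun x => h x * starRingEnd ℂ (g x) with hT
  have hT0 : Tendsto T (𝓝[>] 0) (𝓝 c) :=
    hht.mul ((Complex.continuous_conj.tendsto _).comp hgt)
  have hTb : ∀ b : ℝ, 0 < b → T b = c + ∫ x in (0:ℝ)..b, Φ x := by
    intro b hb
    have p1 := intervalIntegral.continuousOn_primitive_interval' (a := 0) (hΦii 0 b le_rfl hb.le)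
      left_mem_uIcc
    rw [uIcc_of_le hb.le] at p1
    have p2 : Tendsto (fun a => ∫ x in (0:ℝ)..a, Φ x) (𝓝[>] 0) (𝓝 (∫ x in (0:ℝ)..0, Φ x)) :=
      (p1 0 (by simp [hb.le])).mono_left (by
        rw [← nhdsWithin_Ioc_eq_nhdsGT hb]
        exact nhdsWithin_mono _ Ioc_subset_Icc_self)
    rw [intervalIntegral.integral_same] at p2
    have p3 : Tendsto (fun a => T a + ((∫ x in (0:ℝ)..b, Φ x) - ∫ x in (0:ℝ)..a, Φ x)) (𝓝[>] 0)
        (𝓝 (c + ((∫ x in (0:ℝ)..b, Φ x) - 0))) := hT0.add (p2.const_sub _)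
    rw [sub_zero] at p3
    refine tendsto_nhds_unique (tendsto_const_nhds.congr' ?_) p3
    filter_upwards [Ioc_mem_nhdsGT hb] with a ha
    rw [intervalIntegral.integral_interval_sub_left (hΦii 0 b le_rfl hb.le)
      (hΦii 0 a le_rfl ha.1.le), ← hQ a b ha.1 ha.2]
    ring
  have hTinf : Tendsto T atTop (𝓝 (c + ∫ x in Ioi (0:ℝ), Φ x)) := by
    refine ((intervalIntegral_tendsto_integral_Ioi 0 hΦi tendsto_id).const_add c).congr' ?_
    filter_upwards [eventually_gt_atTop 0] with b hb
    exact (hTb b hb).symm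
  have hTi : IntegrableOn T (Ioi (0:ℝ)) := by
    refine (hint w v).congr ?_
    filter_upwards [(ae_restrict_iff' measurableSet_Ioi).2 hae] with x hx
    exact hx.symm
  have hL : c + ∫ x in Ioi (0:ℝ), Φ x = 0 := by
    by_contra hne
    set L := c + ∫ x in Ioi (0:ℝ), Φ x with hLdef
    have hLp : 0 < ‖L‖ / 2 := by positivity
    have ev : ∀ᶠ x in atTop, ‖L‖ / 2 ≤ ‖T x‖ := by
      have := hTinf.norm.eventually (lt_mem_nhds (half_lt_self (norm_pos_iff.2 hne)))
      exact this.mono fun x hx => hx.le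
    obtain ⟨R, hR⟩ := eventually_atTop.1 ev
    have hfin := hTi.measure_norm_ge_lt_top hLp
    have hsub : Ioi (max R 0) ⊆ {x | ‖L‖ / 2 ≤ ‖T x‖} ∩ Ioi 0 := fun x hx =>
      ⟨hR x ((le_max_left _ _).trans hx.le), (show (0:ℝ) < x from (le_max_right _ _).trans_lt hx)⟩
    have := (measure_mono hsub).trans (Measure.le_restrict_apply _ _ (μ := volume))
    rw [Real.volume_Ioi] at this
    exact absurd hfin (not_lt.2 this)
  rw [hinner, hinner]
  have : ∫ x in Ioi (0:ℝ), Φ x = (∫ x in Ioi (0:ℝ), w x * starRingEnd ℂ (v' x))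
      - ∫ x in Ioi (0:ℝ), z x * starRingEnd ℂ (v x) := integral_sub (hint w v') (hint z v)
  rw [this] at hL
  linear_combination -hL


/-! ### The spaces `ℋ̃^s(ℝ₊)`, `0 < ν < 1` -/

/-- Boundary data `(φ₋, φ₊)`, with `φ₋ = φ 0` and `φ₊ = φ 1`. -/
abbrev BData : Type := EuclideanSpace ℂ (Fin 2)

/-- `ℋ̃⁰(ℝ₊) = L² × ℂ²`. -/
abbrev Ht0 : Type := WithLp 2 (L2 × BData)

/-- The `(u, φ)` with `u ∈ ℋ¹`, `φ₋ = γ₋ u` and `φ₊` arbitrary. -/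
def Ht1Submodule (ν : ℝ) (h0 : 0 < ν) : Submodule ℂ (WithLp 2 (H1 ν × BData)) where
  carrier := {U | U.snd 0 = gammaMinus ν h0 U.fst}
  zero_mem' := by simp
  add_mem' := fun {U V} hU hV => by
    simp only [mem_ofPred_eq] at hU hV
    simp [hU, hV]
  smul_mem' := fun c U hU => by
    simp only [mem_ofPred_eq] at hU
    simp [hU]

/-- `ℋ̃¹(ℝ₊)`. -/
def Ht1 (ν : ℝ) (h0 : 0 < ν) : Type := Ht1Submodule ν h0

instance (ν : ℝ) (h0 : 0 < ν) : NormedAddCommGroup (Ht1 ν h0) :=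
  inferInstanceAs (NormedAddCommGroup (Ht1Submodule ν h0))

instance (ν : ℝ) (h0 : 0 < ν) : InnerProductSpace ℂ (Ht1 ν h0) :=
  inferInstanceAs (InnerProductSpace ℂ (Ht1Submodule ν h0))

/-- The `(u, φ)` with `u ∈ ℋ²`, `φ₋ = γ₋ u` and `φ₊ = γ₊ u`. -/
def Ht2Submodule (ν : ℝ) (h0 : 0 < ν) (h1 : ν < 1) : Submodule ℂ (WithLp 2 (H2 ν × BData)) where
  carrier := {U | U.snd 0 = gammaMinus ν h0 (H2.toH1 ν U.fst) ∧ U.snd 1 = gammaPlus ν h1 U.fst}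
  zero_mem' := by simp
  add_mem' := fun {U V} hU hV => by
    simp only [mem_ofPred_eq] at hU hV
    simp [hU.1, hV.1, hU.2, hV.2]
  smul_mem' := fun c U hU => by
    simp only [mem_ofPred_eq] at hU
    simp [hU.1, hU.2]

/-- `ℋ̃²(ℝ₊)`. -/
def Ht2 (ν : ℝ) (h0 : 0 < ν) (h1 : ν < 1) : Type := Ht2Submodule ν h0 h1

instance (ν : ℝ) (h0 : 0 < ν) (h1 : ν < 1) : NormedAddCommGroup (Ht2 ν h0 h1) :=
  inferInstanceAs (NormedAddCommGroup (Ht2Submodule ν h0 h1))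

instance (ν : ℝ) (h0 : 0 < ν) (h1 : ν < 1) : InnerProductSpace ℂ (Ht2 ν h0 h1) :=
  inferInstanceAs (InnerProductSpace ℂ (Ht2Submodule ν h0 h1))

namespace Ht0

/-- `(u, φ) ↦ u`. -/
def fn : Ht0 →L[ℂ] L2 := WithLp.fstL 2 ℂ L2 BData

/-- `(u, φ) ↦ φ`. -/
def bdry : Ht0 →L[ℂ] BData := WithLp.sndL 2 ℂ L2 BData

end Ht0

namespace Ht1

/-- `(u, φ) ↦ u`. -/
def fn (ν : ℝ) (h0 : 0 < ν) : Ht1 ν h0 →L[ℂ] H1 ν :=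
  (WithLp.fstL 2 ℂ (H1 ν) BData).comp (Ht1Submodule ν h0).subtypeL

/-- `(u, φ) ↦ φ`. -/
def bdry (ν : ℝ) (h0 : 0 < ν) : Ht1 ν h0 →L[ℂ] BData :=
  (WithLp.sndL 2 ℂ (H1 ν) BData).comp (Ht1Submodule ν h0).subtypeL

end Ht1

namespace Ht2

/-- `(u, φ) ↦ u`. -/
def fn (ν : ℝ) (h0 : 0 < ν) (h1 : ν < 1) : Ht2 ν h0 h1 →L[ℂ] H2 ν :=
  (WithLp.fstL 2 ℂ (H2 ν) BData).comp (Ht2Submodule ν h0 h1).subtypeL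

/-- `(u, φ) ↦ φ`. -/
def bdry (ν : ℝ) (h0 : 0 < ν) (h1 : ν < 1) : Ht2 ν h0 h1 →L[ℂ] BData :=
  (WithLp.sndL 2 ℂ (H2 ν) BData).comp (Ht2Submodule ν h0 h1).subtypeL

end Ht2

/-! ### The operator `P = |D_ν|² + a` -/

/-- The space of continuous antilinear functionals on `X`, with the operator norm. -/
abbrev AntiDual (X : Type) [NormedAddCommGroup X] [NormedSpace ℂ X] : Type := X →L⋆[ℂ] ℂ

/-- For continuous linear `A : X → E`, `B : Y → E` into an inner product space, the map
`x ↦ (y ↦ ⟨A x, B y⟩)`, where `⟨u, v⟩` is linear in `u` and antilinear in `v`. -/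
def pairing {X Y E : Type} [NormedAddCommGroup X] [NormedSpace ℂ X] [NormedAddCommGroup Y]
    [NormedSpace ℂ Y] [NormedAddCommGroup E] [InnerProductSpace ℂ E]
    (A : X →L[ℂ] E) (B : Y →L[ℂ] E) : X →L[ℂ] AntiDual Y :=
  (innerSLFlip ℂ).bilinearComp A B

lemma pairing_apply {X Y E : Type} [NormedAddCommGroup X] [NormedSpace ℂ X] [NormedAddCommGroup Y]
    [NormedSpace ℂ Y] [NormedAddCommGroup E] [InnerProductSpace ℂ E]
    (A : X →L[ℂ] E) (B : Y →L[ℂ] E) (x : X) (y : Y) :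
    pairing A B x y = inner ℂ (B y) (A x) := rfl

/-- The coordinate `φ ↦ φ i` of the boundary data. -/
def coord (i : Fin 2) : BData →L[ℂ] ℂ := EuclideanSpace.proj i

/-- `P` on `ℋ²`. -/
def opH2 (ν : ℝ) (a : ℂ) : H2 ν →L[ℂ] L2 := H2.dd ν + a • H2.incl ν

/-- `P : ℋ¹ → ℋ⁻¹` without boundary terms: `⟨P u, v⟩ = ⟨D_ν u, D_ν v⟩ + a ⟨u, v⟩`. -/
def opH1 (ν : ℝ) (a : ℂ) : H1 ν →L[ℂ] AntiDual (H1 ν) :=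
  pairing (H1.d ν) (H1.d ν) + a • pairing (H1.incl ν) (H1.incl ν)

/-- `P : ℋ⁰ → ℋ⁻²` without boundary terms: `⟨P u, v⟩ = ⟨u, P^* v⟩`, `P^* = |D_ν|² + conj a`. -/
def opH0 (ν : ℝ) (a : ℂ) : L2 →L[ℂ] AntiDual (H2 ν) :=
  pairing (ContinuousLinearMap.id ℂ L2) (opH2 ν (starRingEnd ℂ a))

/-- `P : ℋ̃² → ℋ⁰`, `0 < ν < 1`. -/
def opHt2 (ν : ℝ) (h0 : 0 < ν) (h1 : ν < 1) (a : ℂ) : Ht2 ν h0 h1 →L[ℂ] L2 :=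
  (opH2 ν a).comp (Ht2.fn ν h0 h1)

/-- `P : ℋ̃¹ → ℋ⁻¹`, `0 < ν < 1`, given by Green's formula:
`⟨P (u, φ), v⟩ = ⟨D_ν u, D_ν v⟩ + a ⟨u, v⟩ + ⟨φ₊, γ₋ v⟩`. -/
def opHt1 (ν : ℝ) (h0 : 0 < ν) (a : ℂ) : Ht1 ν h0 →L[ℂ] AntiDual (H1 ν) :=
  (opH1 ν a).comp (Ht1.fn ν h0)
    + pairing ((coord 1).comp (Ht1.bdry ν h0)) (gammaMinus ν h0)

/-- `P : ℋ̃⁰ → ℋ⁻²`, `0 < ν < 1`, given by Green's formula: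
`⟨P (u, φ), v⟩ = ⟨u, P^* v⟩ + ⟨φ₊, γ₋ v⟩ - ⟨φ₋, γ₊ v⟩`. -/
def opHt0 (ν : ℝ) (h0 : 0 < ν) (h1 : ν < 1) (a : ℂ) : Ht0 →L[ℂ] AntiDual (H2 ν) :=
  (opH0 ν a).comp Ht0.fn
    + pairing ((coord 1).comp Ht0.bdry) ((gammaMinus ν h0).comp (H2.toH1 ν))
    - pairing ((coord 0).comp Ht0.bdry) (gammaPlus ν h1)

/-- The three versions of `P` are extensions of the same operator: for `u ∈ ℋ²`, the functional
`P (u, γ₋ u, γ₊ u) ∈ ℋ⁻¹` is the function `P u ∈ L²`. -/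
lemma opHt1_eq {ν : ℝ} (h0 : 0 < ν) (h1 : ν < 1) (a : ℂ) (u : H2 ν) (U : Ht1 ν h0)
    (hu : Ht1.fn ν h0 U = H2.toH1 ν u) (hp : Ht1.bdry ν h0 U 1 = gammaPlus ν h1 u) (v : H1 ν) :
    opHt1 ν h0 a U v = inner ℂ (H1.incl ν v) (opH2 ν a u) := by
  have h : inner ℂ (H1.incl ν v) (opH2 ν a u) = inner ℂ (H1.incl ν v) (H2.dd ν u)
      + a * inner ℂ (H1.incl ν v) (H2.incl ν u) := by
    simp [opH2, inner_add_right, inner_smul_right]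
  have e : opHt1 ν h0 a U v = inner ℂ (H1.d ν v) (H1.d ν (Ht1.fn ν h0 U))
      + a * inner ℂ (H1.incl ν v) (H1.incl ν (Ht1.fn ν h0 U))
      + inner ℂ (gammaMinus ν h0 v) (Ht1.bdry ν h0 U 1) := rfl
  rw [h, e, green h0 h1 u v, hu, hp, RCLike.inner_apply]
  simp only [H2.incl, H2.d, ContinuousLinearMap.comp_apply]
  ring

/-- For `u ∈ ℋ²`, the functional `P (u, γ₋ u, γ₊ u) ∈ ℋ⁻²` is the function `P u ∈ L²`. -/
lemma opHt0_eq {ν : ℝ} (h0 : 0 < ν) (h1 : ν < 1) (a : ℂ) (u : H2 ν) (U : Ht0)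
    (hu : Ht0.fn U = H2.incl ν u) (hm : Ht0.bdry U 0 = gammaMinus ν h0 (H2.toH1 ν u))
    (hp : Ht0.bdry U 1 = gammaPlus ν h1 u) (v : H2 ν) :
    opHt0 ν h0 h1 a U v = inner ℂ (H2.incl ν v) (opH2 ν a u) := by
  have h : inner ℂ (H2.incl ν v) (opH2 ν a u) = inner ℂ (H2.incl ν v) (H2.dd ν u)
      + a * inner ℂ (H2.incl ν v) (H2.incl ν u) := by
    simp [opH2, inner_add_right, inner_smul_right]
  have h' : inner ℂ (opH2 ν (starRingEnd ℂ a) v) (H2.incl ν u)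
      = inner ℂ (H2.dd ν v) (H2.incl ν u) + a * inner ℂ (H2.incl ν v) (H2.incl ν u) := by
    simp [opH2, inner_add_left, inner_smul_left]
  have e : opHt0 ν h0 h1 a U v = inner ℂ (opH2 ν (starRingEnd ℂ a) v) (Ht0.fn U)
      + inner ℂ (gammaMinus ν h0 (H2.toH1 ν v)) (Ht0.bdry U 1)
      - inner ℂ (gammaPlus ν h1 v) (Ht0.bdry U 0) := rfl
  have g1 := green h0 h1 u (H2.toH1 ν v)
  have g2 := congrArg (starRingEnd ℂ) (green h0 h1 v (H2.toH1 ν u))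
  rw [map_add, inner_conj_symm, inner_conj_symm, map_mul, Complex.conj_conj] at g2
  change inner ℂ (H2.incl ν v) (H2.dd ν u) = inner ℂ (H2.d ν v) (H2.d ν u) + _ at g1
  change inner ℂ (H2.dd ν v) (H2.incl ν u) = inner ℂ (H2.d ν v) (H2.d ν u) + _ at g2
  rw [h, e, hu, h', hm, hp, g1, g2, RCLike.inner_apply, RCLike.inner_apply]
  ring

/-! ### Boundary conditions -/

/-- The coefficients `(a, G, C)` of the boundary value problem: `P = |D_ν|² + a`,
`T_k u = G k 0 * γ₋ u + G k 1 * γ₊ u` for `k = 1, …, J + 1`, and the matrix `C`. -/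
abbrev Coeffs (J : ℕ) : Type :=
  ℂ × Matrix (Fin (J + 1)) (Fin 2) ℂ × Matrix (Fin (J + 1)) (Fin J) ℂ

/-- `ℳ₊`: the solutions on `(0, ∞)` of `|D_ν|² u + a u = 0` which are bounded as `x → ∞`. -/
def boundedSolutions (ν : ℝ) (a : ℂ) : Set (ℝ → ℂ) :=
  {u | ContDiffOn ℝ 2 u (Ioi 0) ∧ (∀ x : ℝ, 0 < x → bdStar ν (bd ν u) x + a * u x = 0) ∧
    ∃ R M : ℝ, ∀ x : ℝ, R ≤ x → ‖u x‖ ≤ M}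

/-- The Lopatinskii condition: the only `(u, u') ∈ ℳ₊ × ℂ^J` with `T u + C u' = 0` is zero.
Here `c₋ = γ₋ u = lim x ^ (ν - 1/2) u` and `c₊ = γ₊ u = lim x ^ (1/2 - ν) ∂_ν u` as `x → 0+`. -/
def Lopatinskii (ν : ℝ) {J : ℕ} (p : Coeffs J) : Prop :=
  ∀ u ∈ boundedSolutions ν p.1, ∀ cm cp : ℂ, ∀ u' : Fin J → ℂ,
    HasWeightedTrace (ν - 1 / 2) u cm → HasWeightedTrace (1 / 2 - ν) (bd ν u) cp →
    p.2.1.mulVec ![cm, cp] + p.2.2.mulVec u' = 0 →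
    (∀ x : ℝ, 0 < x → u x = 0) ∧ u' = 0

/-- The coefficients for which `P` is regular, i.e. `a ∉ (-∞, 0]`, and `{P, T, C}` is regular. -/
def regularCoeffs (ν : ℝ) (J : ℕ) : Set (Coeffs J) :=
  {p | p.1 ∈ Complex.slitPlane ∧ Lopatinskii ν p}

/-- The operator `(U, u') ↦ (P U, G φ + C u')`, where `U = (u, φ)`, on spaces `X ∋ U`,
`Y ∋ P U`. -/
def bvp {X Y : Type} [NormedAddCommGroup X] [NormedSpace ℂ X] [NormedAddCommGroup Y]
    [NormedSpace ℂ Y] (P : X →L[ℂ] Y) (bdry : X →L[ℂ] BData) {J : ℕ}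
    (G : Matrix (Fin (J + 1)) (Fin 2) ℂ) (C : Matrix (Fin (J + 1)) (Fin J) ℂ) :
    X × EuclideanSpace ℂ (Fin J) →L[ℂ] Y × EuclideanSpace ℂ (Fin (J + 1)) :=
  (P.comp (ContinuousLinearMap.fst ℂ X _)).prod
    ((G.toEuclideanLin.toContinuousLinearMap.comp bdry).comp (ContinuousLinearMap.fst ℂ X _)
      + C.toEuclideanLin.toContinuousLinearMap.comp (ContinuousLinearMap.snd ℂ X _))

/-- `𝒫 = {P, T, C} : ℋ̃² × ℂ^J → ℋ⁰ × ℂ^(J+1)`. -/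
def bvp2 (ν : ℝ) (h0 : 0 < ν) (h1 : ν < 1) {J : ℕ} (p : Coeffs J) :
    Ht2 ν h0 h1 × EuclideanSpace ℂ (Fin J) →L[ℂ] L2 × EuclideanSpace ℂ (Fin (J + 1)) :=
  bvp (opHt2 ν h0 h1 p.1) (Ht2.bdry ν h0 h1) p.2.1 p.2.2

/-- `𝒫 = {P, T, C} : ℋ̃¹ × ℂ^J → ℋ⁻¹ × ℂ^(J+1)`. -/
def bvp1 (ν : ℝ) (h0 : 0 < ν) {J : ℕ} (p : Coeffs J) :
    Ht1 ν h0 × EuclideanSpace ℂ (Fin J) →L[ℂ]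
      AntiDual (H1 ν) × EuclideanSpace ℂ (Fin (J + 1)) :=
  bvp (opHt1 ν h0 p.1) (Ht1.bdry ν h0) p.2.1 p.2.2

/-- `𝒫 = {P, T, C} : ℋ̃⁰ × ℂ^J → ℋ⁻² × ℂ^(J+1)`. -/
def bvp0 (ν : ℝ) (h0 : 0 < ν) (h1 : ν < 1) {J : ℕ} (p : Coeffs J) :
    Ht0 × EuclideanSpace ℂ (Fin J) →L[ℂ] AntiDual (H2 ν) × EuclideanSpace ℂ (Fin (J + 1)) :=
  bvp (opHt0 ν h0 h1 p.1) Ht0.bdry p.2.1 p.2.2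

/-- The family `L` of operators depending on parameters consists, for parameters in `S`, of
isomorphisms of normed spaces, and `L p ↦ (L p)⁻¹` and `‖(L p)⁻¹‖` are continuous on `S`
for the operator norm. -/
def IsContinuousIsoFamily {Q X Y : Type} [TopologicalSpace Q] [NormedAddCommGroup X]
    [NormedSpace ℂ X] [NormedAddCommGroup Y] [NormedSpace ℂ Y] (L : Q → X →L[ℂ] Y)
    (S : Set Q) : Prop :=
  (∀ p ∈ S, (L p).IsInvertible) ∧ ContinuousOn (fun p => (L p).inverse) S ∧
    ContinuousOn (fun p => ‖(L p).inverse‖) S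

end BesselBVP
end

/-!
For `a ∉ (-∞, 0]` the form `⟨D_ν u, D_ν v⟩ + a ⟨u, v⟩` is coercive in modulus on `ℋ¹`, because
zero keeps a positive distance from the segment between `1` and `a`. By the Lax–Milgram theorem
`P : ℋ¹ → ℋ⁻¹` without boundary terms is bijective for every `ν` (`opH1_bijective`). A variational
solution with right-hand side in `L²` lies in `ℋ²` (`exists_H2_of_opH1_eq`), and duality carries
results from `ℋ² → ℋ⁰` over to `ℋ⁰ → ℋ⁻²` (`pairing_id_bijective`).

For `ν ≥ 1` this leaves the injectivity of `P` on `ℋ²`. An element `f` of the kernel is a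
classical solution (`exists_isSolutionPair`), and the boundary term `(∂_ν f) f̄` vanishes at zero
and at infinity (`IsSolutionPair.integral_energy_eq_zero`), so that the form vanishes at `(f, f)`.

For `0 < ν < 1` the trace `γ₋` is a nonzero functional on `ℋ¹`, and the Neumann problem `P u = f`,
`γ₊ u = t` is uniquely solvable in `ℋ²` (`exists_opH2_eq_gammaPlus_eq`,
`eq_zero_of_opH2_gammaPlus`). Let `U` be its solution for `f = 0`, `t = 1`. On each of the spaces
`ℋ̃^s` the operator `P` is surjective and its kernel is spanned by `U` with its boundary data
`(γ₋ U, 1)`; for `s = 0` this holds since the `φ₊ = 0` part of `P` is the adjoint of the Neumann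
problem for `P^*` (`opHt0_apply`). Therefore `{P, T, C}` is bijective as soon as the square linear
system `t G (γ₋ U, 1) + C u' = η` is injective (`bvp_bijective`), and this is what the Lopatinskii
condition says, `t U` being an element of `ℳ₊` (`Lopatinskii.injective`).

The operators depend continuously on the coefficients, and inversion is continuous on the
invertible operators between Banach spaces (`isContinuousIsoFamily_of_bijective`).
-/

noncomputable section
namespace BesselBVP

/-! ### Functional analysis -/

section Abstract

variable {X H : Type} [NormedAddCommGroup X] [InnerProductSpace ℂ X]
  [NormedAddCommGroup H] [InnerProductSpace ℂ H]

/-- The Riesz representation theorem for antilinear functionals. -/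
lemma AntiDual.exists_inner_eq [CompleteSpace X] (l : AntiDual X) :
    ∃ x : X, ∀ y : X, l y = inner ℂ y x := by
  let L : StrongDual ℂ X :=
    { toFun := fun y => starRingEnd ℂ (l y)
      map_add' := fun x y => by simp
      map_smul' := fun c y => by simp
      cont := Complex.continuous_conj.comp l.continuous }
  refine ⟨(InnerProductSpace.toDual ℂ X).symm L, fun y => ?_⟩
  rw [← inner_conj_symm, InnerProductSpace.toDual_symm_apply]
  exact (Complex.conj_conj _).symm

/-- The Lax–Milgram theorem for sesquilinear forms that are coercive in modulus. -/
lemma bijective_of_coercive [CompleteSpace X] (A : X →L[ℂ] AntiDual X) {c : ℝ} (hc : 0 < c)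
    (h : ∀ x, c * ‖x‖ ^ 2 ≤ ‖A x x‖) : Function.Bijective A := by
  have hlow : ∀ x, ‖x‖ ≤ c⁻¹ * ‖A x‖ := fun x => by
    rcases eq_or_ne x 0 with rfl | hx
    · simp
    have hx' : 0 < ‖x‖ := norm_pos_iff.2 hx
    have h1 := (h x).trans ((A x).le_opNorm x)
    rw [inv_mul_eq_div, le_div_iff₀ hc]
    nlinarith
  have hanti : AntilipschitzWith c⁻¹.toNNReal A := by
    refine A.antilipschitz_of_bound fun x => ?_
    rw [Real.coe_toNNReal _ (inv_nonneg.2 hc.le)]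
    exact hlow x
  refine ⟨hanti.injective, ?_⟩
  have hR : Function.Bijective (innerSLFlip ℂ : X →L[ℂ] AntiDual X) := by
    refine ⟨(injective_iff_map_eq_zero _).2 fun x hx => ?_, fun l => ?_⟩
    · have := DFunLike.congr_fun hx x
      simpa using this
    · obtain ⟨x, hx⟩ := AntiDual.exists_inner_eq l
      exact ⟨x, ContinuousLinearMap.ext fun y => (hx y).symm⟩
  let R : X ≃L[ℂ] AntiDual X := ContinuousLinearEquiv.ofBijective (innerSLFlip ℂ)
    (LinearMap.ker_eq_bot.2 hR.1) (LinearMap.range_eq_top.2 hR.2)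
  have hRi : ∀ (l : AntiDual X) (y : X), inner ℂ y (R.symm l) = l y := fun l y => by
    conv_rhs => rw [← R.apply_symm_apply l]
    rfl
  -- The range of `B` is closed, and a vector orthogonal to it is annihilated by the form.
  let B : X →L[ℂ] X := (R.symm : AntiDual X →L[ℂ] X).comp A
  have hclosed : IsClosed (B.range : Set X) := by
    have : (B.range : Set X) = R.symm '' range A := by
      ext x; simp [B]
    rw [this]
    exact R.symm.toHomeomorph.isClosed_image.2 (hanti.isClosed_range A.uniformContinuous)
  have htop : B.range = ⊤ := by
    have := hclosed.completeSpace_coe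
    rw [← B.range.orthogonal_orthogonal, Submodule.eq_top_iff']
    intro v w hw
    have h0 : A w w = 0 := by
      rw [← hRi, ← inner_conj_symm]
      exact (congrArg _ (hw _ ⟨w, rfl⟩)).trans (map_zero _)
    have h1 := h w
    rw [h0, norm_zero] at h1
    have : w = 0 := by
      by_contra hne
      have : 0 < c * ‖w‖ ^ 2 := by positivity
      linarith
    rw [this, inner_zero_left]
  intro l
  obtain ⟨x, hx⟩ : R.symm l ∈ B.range := htop ▸ Submodule.mem_top
  exact ⟨x, R.symm.injective hx⟩

/-- The adjoint of a bijective operator `X → H` is a bijection of `H` onto the antidual of `X`. -/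
lemma pairing_id_bijective [CompleteSpace X] [CompleteSpace H] {B : X →L[ℂ] H}
    (hB : Function.Bijective B) :
    Function.Bijective (pairing (ContinuousLinearMap.id ℂ H) B) := by
  refine ⟨(injective_iff_map_eq_zero _).2 fun u hu => ?_, fun l => ?_⟩
  · obtain ⟨v, rfl⟩ := hB.2 u
    exact inner_self_eq_zero.1 (DFunLike.congr_fun hu v)
  · let e : X ≃L[ℂ] H := ContinuousLinearEquiv.ofBijective B
      (LinearMap.ker_eq_bot.2 hB.1) (LinearMap.range_eq_top.2 hB.2)
    obtain ⟨u, hu⟩ := AntiDual.exists_inner_eq (l.comp (e.symm : H →L[ℂ] X))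
    refine ⟨u, ContinuousLinearMap.ext fun v => ?_⟩
    have := hu (e v)
    rw [ContinuousLinearMap.comp_apply, ContinuousLinearEquiv.coe_coe,
      e.symm_apply_apply] at this
    exact this.symm

end Abstract

/-- Inversion is continuous on the open set of invertible operators between Banach spaces. -/
lemma isContinuousIsoFamily_of_bijective {Q X Y : Type} [TopologicalSpace Q]
    [NormedAddCommGroup X] [NormedSpace ℂ X] [NormedAddCommGroup Y] [NormedSpace ℂ Y]
    [CompleteSpace X] [CompleteSpace Y] {L : Q → X →L[ℂ] Y} {S : Set Q} (hL : Continuous L)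
    (h : ∀ p ∈ S, Function.Bijective (L p)) : IsContinuousIsoFamily L S := by
  have hinv : ∀ p ∈ S, (L p).IsInvertible := fun p hp =>
    ⟨ContinuousLinearEquiv.ofBijective (L p) (LinearMap.ker_eq_bot.2 (h p hp).1)
      (LinearMap.range_eq_top.2 (h p hp).2), rfl⟩
  have hcont : ContinuousOn (fun p => (L p).inverse) S := fun p hp =>
    (ContinuousAt.comp (g := ContinuousLinearMap.inverse) (f := L)
      ((hinv p hp).contDiffAt_map_inverse (n := 0)).continuousAt
      hL.continuousAt).continuousWithinAt
  exact ⟨hinv, hcont, hcont.norm⟩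

lemma continuous_bvp {Q X Y : Type} [TopologicalSpace Q] [NormedAddCommGroup X]
    [NormedSpace ℂ X] [NormedAddCommGroup Y] [NormedSpace ℂ Y] {P : Q → X →L[ℂ] Y}
    (hP : Continuous P) (bdry : X →L[ℂ] BData) {J : ℕ}
    {G : Q → Matrix (Fin (J + 1)) (Fin 2) ℂ} (hG : Continuous G)
    {C : Q → Matrix (Fin (J + 1)) (Fin J) ℂ} (hC : Continuous C) :
    Continuous fun q => bvp (P q) bdry (G q) (C q) := by
  -- A linear map on the finite-dimensional space of matrices is continuous.
  have hmat : ∀ n : ℕ, Continuous fun M : Matrix (Fin (J + 1)) (Fin n) ℂ =>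
      M.toEuclideanLin.toContinuousLinearMap := fun n =>
    (LinearMap.toContinuousLinearMap.toLinearMap ∘ₗ
      (Matrix.toEuclideanLin (𝕜 := ℂ) (m := Fin (J + 1)) (n := Fin n)).toLinearMap
      ).continuous_of_finiteDimensional
  have h1 : Continuous fun q => (P q).comp
      (ContinuousLinearMap.fst ℂ X (EuclideanSpace ℂ (Fin J))) := hP.clm_comp_const _
  have h2 : Continuous fun q => (((G q).toEuclideanLin.toContinuousLinearMap.comp bdry).comp
      (ContinuousLinearMap.fst ℂ X _) + (C q).toEuclideanLin.toContinuousLinearMap.comp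
        (ContinuousLinearMap.snd ℂ X (EuclideanSpace ℂ (Fin J)))) :=
    ((((hmat 2).comp hG).clm_comp_const _).clm_comp_const _).add
      (((hmat J).comp hC).clm_comp_const _)
  exact (ContinuousLinearMap.prodₗᵢ ℂ).continuous.comp (h1.prodMk h2)

/-- Reduction of the boundary value problem to a square linear system: the kernel of `P` is
spanned by `e`, normalized by `φ₊ = 1`, so that the problem is bijective as soon as the
`(J + 1) × (J + 1)` system for the multiple `t` of `e` and for `u'` is injective. -/
lemma bvp_bijective {X Y : Type} [NormedAddCommGroup X] [NormedSpace ℂ X]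
    [NormedAddCommGroup Y] [NormedSpace ℂ Y] {P : X →L[ℂ] Y} {bdry : X →L[ℂ] BData} {J : ℕ}
    {G : Matrix (Fin (J + 1)) (Fin 2) ℂ} {C : Matrix (Fin (J + 1)) (Fin J) ℂ}
    {e : X} (he : P e = 0) (he1 : bdry e 1 = 1)
    (hinj : ∀ x, P x = 0 → bdry x 1 = 0 → x = 0) (hsurj : Function.Surjective P)
    (hM : ∀ (t : ℂ) (u' : Fin J → ℂ),
      G.mulVec (t • (bdry e).ofLp) + C.mulVec u' = 0 → t = 0 ∧ u' = 0) :
    Function.Bijective (bvp P bdry G C) := by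
  have happ : ∀ x u', bvp P bdry G C (x, u')
      = (P x, WithLp.toLp 2 (G.mulVec (bdry x).ofLp + C.mulVec u'.ofLp)) := fun x u' => rfl
  constructor
  · refine (injective_iff_map_eq_zero _).2 ?_
    rintro ⟨x, u'⟩ h
    rw [happ, Prod.mk_eq_zero] at h
    have hx : x = bdry x 1 • e := by
      rw [← sub_eq_zero]
      refine hinj _ ?_ ?_
      · rw [map_sub, map_smul, he, h.1, smul_zero, sub_zero]
      · simp [he1]
    have hb : (bdry x).ofLp = bdry x 1 • (bdry e).ofLp := by
      conv_lhs => rw [hx, map_smul]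
      rfl
    have h2 : G.mulVec (bdry x).ofLp + C.mulVec u'.ofLp = 0 := by
      have := congrArg WithLp.ofLp h.2
      simpa using this
    rw [hb] at h2
    obtain ⟨ht, hu⟩ := hM _ _ h2
    rw [ht, zero_smul] at hx
    rw [Prod.mk_eq_zero]
    exact ⟨hx, by ext i; exact congrFun hu i⟩
  · let M : ℂ × (Fin J → ℂ) →ₗ[ℂ] (Fin (J + 1) → ℂ) :=
      (LinearMap.toSpanSingleton ℂ _ (G.mulVec (bdry e).ofLp)).coprod C.mulVecLin
    have hMa : ∀ t u', M (t, u') = G.mulVec (t • (bdry e).ofLp) + C.mulVec u' := fun t u' => by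
      simp [M, Matrix.mulVec_smul]
    have hMi : Function.Injective M := (injective_iff_map_eq_zero _).2 fun ⟨t, u'⟩ h => by
      rw [hMa] at h
      rw [Prod.mk_eq_zero]
      exact hM t u' h
    have hMs : Function.Surjective M :=
      (LinearMap.injective_iff_surjective_of_finrank_eq_finrank (by simp [add_comm])).1 hMi
    rintro ⟨y, η⟩
    obtain ⟨x, rfl⟩ := hsurj y
    obtain ⟨⟨t, u'⟩, hu⟩ := hMs (η.ofLp - G.mulVec (bdry x).ofLp)
    refine ⟨(x + t • e, WithLp.toLp 2 u'), ?_⟩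
    rw [happ, map_add, map_smul, he, smul_zero, add_zero, map_add, map_smul]
    refine Prod.ext rfl ?_
    rw [hMa] at hu
    ext i
    have := congrFun hu i
    simp only [Matrix.mulVec_add, Pi.add_apply, Pi.sub_apply, WithLp.ofLp_add,
      WithLp.ofLp_smul] at this ⊢
    linear_combination this

/-! ### Completeness of the function spaces -/

lemma L2.inner_toLp_conj {f : ℝ → ℂ}
    (hf : MemLp (fun x => starRingEnd ℂ (f x)) 2 (volume.restrict (Ioi (0 : ℝ)))) (u : L2) :
    inner ℂ (hf.toLp _) u = ∫ x in Ioi (0 : ℝ), u x * f x := by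
  rw [MeasureTheory.L2.inner_def]
  refine integral_congr_ae ?_
  filter_upwards [hf.coeFn_toLp] with x hx
  rw [hx, RCLike.inner_apply, Complex.conj_conj]

lemma continuous_integral_mul {f : ℝ → ℂ} (hf : Continuous f) (hc : HasCompactSupport f) :
    Continuous fun u : L2 => ∫ x in Ioi (0 : ℝ), u x * f x := by
  have hm : MemLp (fun x => starRingEnd ℂ (f x)) 2 (volume.restrict (Ioi (0 : ℝ))) :=
    ((hf.memLp_of_hasCompactSupport hc).restrict _).star
  have : (fun u : L2 => ∫ x in Ioi (0 : ℝ), u x * f x) = fun u => inner ℂ (hm.toLp _) u := by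
    ext u
    exact (L2.inner_toLp_conj hm u).symm
  rw [this]
  exact continuous_const.inner continuous_id

instance (ν : ℝ) : CompleteSpace (H1 ν) := by
  have : IsClosed (H1Submodule ν : Set (WithLp 2 (L2 × L2))) := by
    have e : (H1Submodule ν : Set (WithLp 2 (L2 × L2)))
        = ⋂ (φ : ℝ → ℂ) (_ : IsTestFunction φ), {U | ∫ x in Ioi (0 : ℝ), U.fst x * bdStar ν φ x
          = ∫ x in Ioi (0 : ℝ), U.snd x * φ x} := by
      ext U
      simp only [mem_iInter]
      rfl
    rw [e]
    refine isClosed_iInter fun φ => isClosed_iInter fun hφ => isClosed_eq ?_ ?_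
    · exact (continuous_integral_mul (hφ.bdStar_cont ν).1 (hφ.bdStar_cont ν).2).comp
        (WithLp.fstL 2 ℂ L2 L2).continuous
    · exact (continuous_integral_mul hφ.1.continuous hφ.2.1).comp
        (WithLp.sndL 2 ℂ L2 L2).continuous
  exact this.completeSpace_coe

instance (ν : ℝ) : CompleteSpace (H2 ν) := by
  have : IsClosed (H2Submodule ν : Set (WithLp 2 (H1 ν × L2))) := by
    have e : (H2Submodule ν : Set (WithLp 2 (H1 ν × L2)))
        = ⋂ (φ : ℝ → ℂ) (_ : IsTestFunction φ), {U | ∫ x in Ioi (0 : ℝ),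
          H1.d ν U.fst x * bd ν φ x = ∫ x in Ioi (0 : ℝ), U.snd x * φ x} := by
      ext U
      simp only [mem_iInter]
      rfl
    rw [e]
    refine isClosed_iInter fun φ => isClosed_iInter fun hφ => isClosed_eq ?_ ?_
    · exact (continuous_integral_mul (hφ.bd_cont ν).1 (hφ.bd_cont ν).2).comp
        ((H1.d ν).comp (WithLp.fstL 2 ℂ (H1 ν) L2)).continuous
    · exact (continuous_integral_mul hφ.1.continuous hφ.2.1).comp
        (WithLp.sndL 2 ℂ (H1 ν) L2).continuous
  exact this.completeSpace_coe

instance (ν : ℝ) (h0 : 0 < ν) : CompleteSpace (Ht1 ν h0) := by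
  have : IsClosed (Ht1Submodule ν h0 : Set (WithLp 2 (H1 ν × BData))) :=
    isClosed_eq ((coord 0).comp (WithLp.sndL 2 ℂ (H1 ν) BData)).continuous
      ((gammaMinus ν h0).comp (WithLp.fstL 2 ℂ (H1 ν) BData)).continuous
  exact this.completeSpace_coe

instance (ν : ℝ) (h0 : 0 < ν) (h1 : ν < 1) : CompleteSpace (Ht2 ν h0 h1) := by
  have : IsClosed (Ht2Submodule ν h0 h1 : Set (WithLp 2 (H2 ν × BData))) :=
    (isClosed_eq ((coord 0).comp (WithLp.sndL 2 ℂ (H2 ν) BData)).continuous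
      (((gammaMinus ν h0).comp (H2.toH1 ν)).comp (WithLp.fstL 2 ℂ (H2 ν) BData)).continuous).inter
    (isClosed_eq ((coord 1).comp (WithLp.sndL 2 ℂ (H2 ν) BData)).continuous
      ((gammaPlus ν h1).comp (WithLp.fstL 2 ℂ (H2 ν) BData)).continuous)
  exact this.completeSpace_coe

/-! ### Classical derivatives, test functions and traces -/

lemma integrableOn_mul_of_tsupport_subset {g ψ : ℝ → ℂ} (hg : ContinuousOn g (Ioi 0))
    (hψ : Continuous ψ) (hc : HasCompactSupport ψ) (hs : tsupport ψ ⊆ Ioi (0 : ℝ)) :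
    IntegrableOn (fun x => g x * ψ x) (Ioi (0 : ℝ)) := by
  have h1 : IntegrableOn (fun x => g x * ψ x) (tsupport ψ) :=
    ((hg.mono hs).mul hψ.continuousOn).integrableOn_compact hc
  refine h1.of_forall_sdiff_eq_zero measurableSet_Ioi fun x hx => ?_
  rw [image_eq_zero_of_notMem_tsupport hx.2, mul_zero]

lemma div_ofReal_continuousOn (c : ℝ) :
    ContinuousOn (fun x : ℝ => ((c / x : ℝ) : ℂ)) (Ioi 0) :=
  Complex.continuous_ofReal.comp_continuousOn
    (continuousOn_const.div continuousOn_id fun _ hx => ne_of_gt hx)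

/-- A classical derivative is a derivative in the sense of distributions. -/
lemma isWeakD_of_hasDerivAt (ν : ℝ) {f f' : ℝ → ℂ} (hf : ∀ x, 0 < x → HasDerivAt f (f' x) x)
    (hf' : ContinuousOn f' (Ioi 0)) :
    IsWeakD ν f fun x => f' x + ((ν - 1 / 2) / x : ℝ) * f x := by
  intro φ hφ
  have hfc : ContinuousOn f (Ioi 0) := fun x hx => (hf x hx).continuousAt.continuousWithinAt
  have hds : tsupport (deriv φ) ⊆ Ioi (0 : ℝ) := tsupport_deriv_subset.trans hφ.2.2
  have hdc : Continuous (deriv φ) := hφ.1.continuous_deriv (by simp)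
  have i1 := integrableOn_mul_of_tsupport_subset hfc hdc hφ.2.1.deriv hds
  have i2 := integrableOn_mul_of_tsupport_subset hf' hφ.1.continuous hφ.2.1 hφ.2.2
  have i3 : IntegrableOn (fun x => ((ν - 1 / 2) / x : ℝ) * f x * φ x) (Ioi (0 : ℝ)) :=
    integrableOn_mul_of_tsupport_subset ((div_ofReal_continuousOn (ν - 1 / 2)).mul hfc)
      hφ.1.continuous hφ.2.1 hφ.2.2
  have h0 : Tendsto (f * φ) (𝓝[>] 0) (𝓝 0) := by
    refine tendsto_const_nhds.congr' ?_
    filter_upwards [nhdsWithin_le_nhds hφ.zero_near] with x hx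
    simp [hx]
  have hinf : Tendsto (f * φ) atTop (𝓝 0) := by
    obtain ⟨a, b, _, _, h⟩ := hφ.exists_Ioo
    refine tendsto_const_nhds.congr' ?_
    filter_upwards [eventually_gt_atTop b] with x hx
    simp [h x fun hx' => lt_asymm hx hx'.2]
  have key := integral_Ioi_mul_deriv_eq_deriv_mul (fun x hx => hf x hx)
    (fun x _ => (hφ.1.differentiable (by simp) x).hasDerivAt) i1 i2 h0 hinf
  have e1 : ∫ x in Ioi (0 : ℝ), f x * bdStar ν φ x
      = -(∫ x in Ioi (0 : ℝ), f x * deriv φ x)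
        + ∫ x in Ioi (0 : ℝ), ((ν - 1 / 2) / x : ℝ) * f x * φ x := by
    rw [← integral_neg]
    refine Eq.trans ?_ (integral_add i1.neg i3)
    congr 1 with x
    simp only [bdStar]
    ring
  have e2 : ∫ x in Ioi (0 : ℝ), (f' x + ((ν - 1 / 2) / x : ℝ) * f x) * φ x
      = (∫ x in Ioi (0 : ℝ), f' x * φ x)
        + ∫ x in Ioi (0 : ℝ), ((ν - 1 / 2) / x : ℝ) * f x * φ x := by
    refine Eq.trans ?_ (integral_add i2 i3)
    congr 1 with x
    ring
  rw [e1, e2, key]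
  ring

/-- The element of `ℋ¹` given by functions `f, w ∈ L²` with `∂_ν f = w`. -/
def H1.ofWeakD {ν : ℝ} {f w : ℝ → ℂ} (hf : MemLp f 2 (volume.restrict (Ioi (0 : ℝ))))
    (hw : MemLp w 2 (volume.restrict (Ioi (0 : ℝ)))) (h : IsWeakD ν f w) : H1 ν :=
  ⟨WithLp.toLp 2 (hf.toLp f, hw.toLp w), fun φ hφ => by
    refine Eq.trans ?_ ((h φ hφ).trans ?_)
    · refine integral_congr_ae ?_
      filter_upwards [hf.coeFn_toLp] with x hx
      exact congrArg (· * _) hx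
    · refine integral_congr_ae ?_
      filter_upwards [hw.coeFn_toLp] with x hx
      exact congrArg (· * _) hx.symm⟩

lemma IsTestFunction.isWeakD {φ : ℝ → ℂ} (h : IsTestFunction φ) (ν : ℝ) :
    IsWeakD ν φ (bd ν φ) :=
  isWeakD_of_hasDerivAt ν (fun x _ => (h.1.differentiable (by simp) x).hasDerivAt)
    (h.1.continuous_deriv (by simp)).continuousOn

lemma IsTestFunction.memLp {φ : ℝ → ℂ} (h : IsTestFunction φ) :
    MemLp φ 2 (volume.restrict (Ioi (0 : ℝ))) :=
  (h.1.continuous.memLp_of_hasCompactSupport h.2.1).restrict _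

lemma IsTestFunction.memLp_bd {φ : ℝ → ℂ} (h : IsTestFunction φ) (ν : ℝ) :
    MemLp (bd ν φ) 2 (volume.restrict (Ioi (0 : ℝ))) :=
  ((h.bd_cont ν).1.memLp_of_hasCompactSupport (h.bd_cont ν).2).restrict _

/-- A test function as an element of `ℋ¹`. -/
def IsTestFunction.toH1 {φ : ℝ → ℂ} (h : IsTestFunction φ) (ν : ℝ) : H1 ν :=
  H1.ofWeakD h.memLp (h.memLp_bd ν) (h.isWeakD ν)

lemma gammaMinus_ofWeakD {ν : ℝ} (h0 : 0 < ν) {f w : ℝ → ℂ}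
    (hf : MemLp f 2 (volume.restrict (Ioi (0 : ℝ))))
    (hw : MemLp w 2 (volume.restrict (Ioi (0 : ℝ)))) (h : IsWeakD ν f w)
    (hc : ContinuousOn f (Ioi 0)) {c : ℂ} (ht : HasWeightedTrace (ν - 1 / 2) f c) :
    gammaMinus ν h0 (H1.ofWeakD hf hw h) = c :=
  (traceOf_spec _ _ (H1.exists_trace h0) _).unique ⟨f, hc, hf.coeFn_toLp, ht⟩

lemma IsTestFunction.gammaMinus_toH1 {φ : ℝ → ℂ} (h : IsTestFunction φ) {ν : ℝ} (h0 : 0 < ν) :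
    gammaMinus ν h0 (h.toH1 ν) = 0 := by
  refine gammaMinus_ofWeakD h0 _ _ _ h.1.continuous.continuousOn ?_
  refine tendsto_const_nhds.congr' ?_
  filter_upwards [nhdsWithin_le_nhds h.zero_near] with x hx
  simp [hx]

/-- The trace `γ₋` does not vanish on `ℋ¹`: it equals `1` on `x ^ (1/2 - ν) e ^ (-x)`. -/
lemma exists_gammaMinus_eq_one {ν : ℝ} (h0 : 0 < ν) (h1 : ν < 1) :
    ∃ v : H1 ν, gammaMinus ν h0 v = 1 := by
  set κ : ℝ := 1 / 2 - ν with hκ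
  set f : ℝ → ℂ := fun x => ((x ^ κ : ℝ) : ℂ) * (Real.exp (-x) : ℝ) with hf
  have hexp : ∀ x : ℝ, HasDerivAt (fun x : ℝ => ((Real.exp (-x) : ℝ) : ℂ))
      (-(Real.exp (-x) : ℝ)) x := fun x => by
    simpa using ((Real.hasDerivAt_exp (-x)).comp x (hasDerivAt_neg x)).ofReal_comp
  have hd : ∀ x, 0 < x → HasDerivAt f (-f x + ((κ / x : ℝ) : ℂ) * f x) x := fun x hx =>
    (hasDerivAt_rpow_mul κ hx (hexp x)).congr_deriv (by simp only [hf]; ring)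
  have hfc : ContinuousOn f (Ioi 0) := fun x hx => (hd x hx).continuousAt.continuousWithinAt
  have hm : MemLp f 2 (volume.restrict (Ioi (0 : ℝ))) := by
    rw [memLp_two_iff_integrable_sq_norm (hfc.aestronglyMeasurable measurableSet_Ioi)]
    have : IntegrableOn (fun x : ℝ => x ^ (2 * κ) * Real.exp (-2 * x)) (Ioi 0) := by
      simpa only [Real.rpow_one] using integrableOn_rpow_mul_exp_neg_mul_rpow (p := 1) (s := 2 * κ)
        (b := 2) (by rw [hκ]; linarith) one_pos two_pos
    refine this.congr_fun (fun x hx => ?_) measurableSet_Ioi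
    have hx' : (0 : ℝ) < x := hx
    simp only [hf]
    rw [norm_mul, Complex.norm_real, Complex.norm_real, Real.norm_of_nonneg (Real.exp_pos _).le,
      Real.norm_of_nonneg (Real.rpow_nonneg hx'.le _), mul_pow, ← Real.exp_nat_mul,
      ← Real.rpow_mul_natCast hx'.le, mul_comm κ]
    push_cast
    ring_nf
  have hw : IsWeakD ν f fun x => -f x := by
    intro φ hφ
    refine (isWeakD_of_hasDerivAt ν hd ?_ φ hφ).trans ?_
    · exact hfc.neg.add ((div_ofReal_continuousOn κ).mul hfc)
    · refine setIntegral_congr_fun measurableSet_Ioi fun x hx => ?_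
      have : (ν - 1 / 2) / x = -(κ / x) := by rw [hκ]; ring
      simp only [this]
      push_cast
      ring
  refine ⟨H1.ofWeakD hm hm.neg hw, gammaMinus_ofWeakD h0 hm hm.neg hw hfc ?_⟩
  have : Tendsto (fun x : ℝ => ((Real.exp (-x) : ℝ) : ℂ)) (𝓝[>] 0) (𝓝 1) := by
    have := (hexp 0).continuousAt.tendsto
    simp only [neg_zero, Real.exp_zero, Complex.ofReal_one] at this
    exact this.mono_left nhdsWithin_le_nhds
  refine this.congr' ?_
  filter_upwards [self_mem_nhdsWithin] with x hx
  rw [hf, ← mul_assoc, ← Complex.ofReal_mul, ← Real.rpow_add hx]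
  simp [hκ]

lemma IsTestFunction.conj {φ : ℝ → ℂ} (h : IsTestFunction φ) :
    IsTestFunction fun x => starRingEnd ℂ (φ x) :=
  ⟨Complex.conjCLE.contDiff.comp h.1, h.2.1.comp_left (map_zero _),
    (tsupport_comp_subset (map_zero _) φ).trans h.2.2⟩

lemma bd_conj (ν : ℝ) (φ : ℝ → ℂ) :
    bd ν (fun x => starRingEnd ℂ (φ x)) = fun x => starRingEnd ℂ (bd ν φ x) := by
  ext x
  simp only [bd, map_add, map_mul, Complex.conj_ofReal]
  congr 1
  exact deriv.star

/-- A variational solution is a solution: if `⟨D_ν u, D_ν φ⟩ + a ⟨u, φ⟩ = ⟨f, φ⟩` for all test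
functions `φ`, then `u ∈ ℋ²` and `P u = f`. -/
lemma exists_H2_of_opH1_eq {ν : ℝ} {a : ℂ} {u : H1 ν} {f : L2}
    (h : ∀ (φ : ℝ → ℂ) (hφ : IsTestFunction φ),
      opH1 ν a u (hφ.toH1 ν) = inner ℂ (H1.incl ν (hφ.toH1 ν)) f) :
    ∃ U : H2 ν, H2.toH1 ν U = u ∧ opH2 ν a U = f := by
  have hweak : IsWeakDStar ν (H1.d ν u) (f - a • H1.incl ν u : L2) := by
    intro φ hφ
    have h1 := h _ hφ.conj
    have e1 : inner ℂ (H1.d ν (hφ.conj.toH1 ν)) (H1.d ν u)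
        = ∫ x in Ioi (0 : ℝ), H1.d ν u x * bd ν φ x := by
      have hm : MemLp (fun x => starRingEnd ℂ (bd ν φ x)) 2 (volume.restrict (Ioi (0 : ℝ))) :=
        (hφ.memLp_bd ν).star
      rw [← L2.inner_toLp_conj hm]
      congr 1
      exact MemLp.toLp_congr (hφ.conj.memLp_bd ν) hm (by rw [bd_conj])
    have e2 : ∀ g : L2, inner ℂ (H1.incl ν (hφ.conj.toH1 ν)) g
        = ∫ x in Ioi (0 : ℝ), g x * φ x := fun g => L2.inner_toLp_conj hφ.conj.memLp g
    have e3 : opH1 ν a u (hφ.conj.toH1 ν) = inner ℂ (H1.d ν (hφ.conj.toH1 ν)) (H1.d ν u)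
      + a * inner ℂ (H1.incl ν (hφ.conj.toH1 ν)) (H1.incl ν u) := rfl
    rw [← e2, ← e1, inner_sub_right, inner_smul_right, ← h1, e3]
    ring
  refine ⟨⟨WithLp.toLp 2 (u, f - a • H1.incl ν u), hweak⟩, rfl, ?_⟩
  exact sub_add_cancel f (a • H1.incl ν u)

/-! ### Classical solutions -/

lemma hasDerivAt_of_sub_eq_integral {g F : ℝ → ℂ} (hF : ContinuousOn F (Ioi 0))
    (h : ∀ a b : ℝ, 0 < a → 0 < b → g b - g a = ∫ x in a..b, F x) {x : ℝ} (hx : 0 < x) :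
    HasDerivAt g (F x) x := by
  have hx1 : Ioi (0 : ℝ) ∈ 𝓝 x := Ioi_mem_nhds hx
  have h1 : HasDerivAt (fun y => ∫ t in x..y, F t) (F x) x :=
    intervalIntegral.integral_hasDerivAt_right (by simp)
      (hF.stronglyMeasurableAtFilter isOpen_Ioi x hx) (hF.continuousAt hx1)
  refine (h1.const_add (g x)).congr_of_eventuallyEq ?_
  filter_upwards [hx1] with y hy
  rw [← h x y hx hy]
  ring

lemma hasDerivAt_conj {g : ℝ → ℂ} {g' : ℂ} {x : ℝ} (h : HasDerivAt g g' x) :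
    HasDerivAt (fun y => starRingEnd ℂ (g y)) (starRingEnd ℂ g') x := h.star

/-- The functions `f` and `w = ∂_ν f` on `(0, ∞)` satisfy the first order system equivalent to
`|D_ν|² f + a f = 0`. -/
structure IsSolutionPair (ν : ℝ) (a : ℂ) (f w : ℝ → ℂ) : Prop where
  left : ∀ x, 0 < x → HasDerivAt f (w x - ((ν - 1 / 2) / x : ℝ) * f x) x
  right : ∀ x, 0 < x → HasDerivAt w (((ν - 1 / 2) / x : ℝ) * w x + a * f x) x

/-- Elements of `ℋ²` annihilated by `P` are classical solutions, almost everywhere equal to `f`. -/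
lemma exists_isSolutionPair {ν : ℝ} {a : ℂ} {U : H2 ν} (hU : opH2 ν a U = 0) :
    ∃ f w : ℝ → ℂ, IsSolutionPair ν a f w ∧
      (∀ᵐ x ∂volume.restrict (Ioi (0 : ℝ)), H2.incl ν U x = f x) ∧
      ∀ᵐ x ∂volume.restrict (Ioi (0 : ℝ)), H2.d ν U x = w x := by
  have hdd : -H2.dd ν U = a • H2.incl ν U := by
    rw [neg_eq_iff_add_eq_zero]
    exact hU
  have hweak := U.isWeakDStar.isWeakD
  rw [hdd] at hweak
  -- Both `u` and `∂_ν u` are powers of `x` times indefinite integrals, each of the other one.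
  obtain ⟨g, hgc, hgd, hg⟩ := exists_rep (H2.toH1 ν U).isWeakD
  obtain ⟨h, hhc, hhd, hh⟩ := exists_rep hweak
  set f : ℝ → ℂ := fun x => ((x ^ (1 / 2 - ν) : ℝ) : ℂ) * g x with hf
  set w : ℝ → ℂ := fun x => ((x ^ (1 / 2 - (1 - ν)) : ℝ) : ℂ) * h x with hw
  have hfc : ContinuousOn f (Ioi 0) := (rpow_continuousOn _).mul hgc
  have hwc : ContinuousOn w (Ioi 0) := (rpow_continuousOn _).mul hhc
  have hcongr : ∀ (κ : ℝ) (u : L2) (F : ℝ → ℂ), (∀ᵐ x, x ∈ Ioi (0 : ℝ) → u x = F x) →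
      ∀ b c : ℝ, 0 < b → 0 < c → ∫ x in b..c, ((x ^ κ : ℝ) : ℂ) * u x
        = ∫ x in b..c, ((x ^ κ : ℝ) : ℂ) * F x := by
    intro κ u F huF b c hb hc
    refine intervalIntegral.integral_congr_ae ?_
    filter_upwards [huF] with x hx hx'
    rw [hx ((lt_min hb hc).trans hx'.1)]
  have hg' : ∀ x, 0 < x → HasDerivAt g (((x ^ (ν - 1 / 2) : ℝ) : ℂ) * w x) x := fun x hx =>
    hasDerivAt_of_sub_eq_integral ((rpow_continuousOn _).mul hwc)
      (fun b c hb hc => (hgd b c hb hc).trans (hcongr _ _ _ hh b c hb hc)) hx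
  have haf : ∀ᵐ x, x ∈ Ioi (0 : ℝ) → (a • H2.incl ν U : L2) x = a * f x := by
    filter_upwards [hg, (ae_restrict_iff' measurableSet_Ioi).1
      (Lp.coeFn_smul a (H2.incl ν U))] with x h1 h2 hx
    rw [h2 hx, Pi.smul_apply, smul_eq_mul]
    exact congrArg (a * ·) (h1 hx)
  have hh' : ∀ x, 0 < x → HasDerivAt h (((x ^ (1 - ν - 1 / 2) : ℝ) : ℂ) * (a * f x)) x :=
    fun x hx => hasDerivAt_of_sub_eq_integral
      ((rpow_continuousOn _).mul (continuousOn_const.mul hfc))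
      (fun b c hb hc => (hhd b c hb hc).trans (hcongr _ _ _ haf b c hb hc)) hx
  have hmul : ∀ (κ κ' : ℝ) (x : ℝ) (z : ℂ), 0 < x → κ + κ' = 0 →
      ((x ^ κ : ℝ) : ℂ) * (((x ^ κ' : ℝ) : ℂ) * z) = z := by
    intro κ κ' x z hx h0
    rw [← mul_assoc, ← Complex.ofReal_mul, ← Real.rpow_add hx, h0, Real.rpow_zero,
      Complex.ofReal_one, one_mul]
  refine ⟨f, w, ⟨fun x hx => ?_, fun x hx => ?_⟩, (ae_restrict_iff' measurableSet_Ioi).2 hg,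
    (ae_restrict_iff' measurableSet_Ioi).2 hh⟩
  · refine (hasDerivAt_rpow_mul (1 / 2 - ν) hx (hg' x hx)).congr_deriv ?_
    rw [mul_add, hmul _ _ _ _ hx (by ring), show (1 / 2 - ν) / x = -((ν - 1 / 2) / x) by ring]
    simp only [hf]
    push_cast
    ring
  · refine (hasDerivAt_rpow_mul (1 / 2 - (1 - ν)) hx (hh' x hx)).congr_deriv ?_
    rw [mul_add, hmul _ _ _ _ hx (by ring), show (1 / 2 - (1 - ν)) / x = (ν - 1 / 2) / x by ring]
    simp only [hw]
    ring

namespace IsSolutionPair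

variable {ν : ℝ} {a : ℂ} {f w : ℝ → ℂ}

lemma continuousOn_left (h : IsSolutionPair ν a f w) : ContinuousOn f (Ioi 0) :=
  fun x hx => (h.left x hx).continuousAt.continuousWithinAt

lemma continuousOn_right (h : IsSolutionPair ν a f w) : ContinuousOn w (Ioi 0) :=
  fun x hx => (h.right x hx).continuousAt.continuousWithinAt

lemma bd_eq (h : IsSolutionPair ν a f w) {x : ℝ} (hx : 0 < x) : bd ν f x = w x := by
  rw [bd, (h.left x hx).deriv]
  ring

/-- The derivative of `|f|²`. -/
lemma hasDerivAt_mul_conj (h : IsSolutionPair ν a f w) {x : ℝ} (hx : 0 < x) :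
    HasDerivAt (fun y => f y * starRingEnd ℂ (f y))
      (w x * starRingEnd ℂ (f x) + f x * starRingEnd ℂ (w x)
        - (((2 * ν - 1) / x : ℝ) : ℂ) * (f x * starRingEnd ℂ (f x))) x := by
  refine ((h.left x hx).mul (hasDerivAt_conj (h.left x hx))).congr_deriv ?_
  simp only [map_sub, map_mul, Complex.conj_ofReal]
  push_cast
  ring

/-- The derivative of `w f̄` is the energy density. -/
lemma hasDerivAt_right_mul_conj (h : IsSolutionPair ν a f w) {x : ℝ} (hx : 0 < x) :
    HasDerivAt (fun y => w y * starRingEnd ℂ (f y))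
      (w x * starRingEnd ℂ (w x) + a * (f x * starRingEnd ℂ (f x))) x := by
  refine ((h.right x hx).mul (hasDerivAt_conj (h.left x hx))).congr_deriv ?_
  simp only [map_sub, map_mul, Complex.conj_ofReal]
  ring

lemma contDiffOn (h : IsSolutionPair ν a f w) : ContDiffOn ℝ 2 f (Ioi 0) := by
  have hdiv : ContDiffOn ℝ 1 (fun x : ℝ => (((ν - 1 / 2) / x : ℝ) : ℂ)) (Ioi 0) :=
    Complex.ofRealCLM.contDiff.comp_contDiffOn
      (contDiffOn_const.div contDiffOn_id fun x hx => ne_of_gt hx)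
  have hC1 : ∀ {g g' : ℝ → ℂ}, (∀ x, 0 < x → HasDerivAt g (g' x) x) →
      ContinuousOn g' (Ioi 0) → ContDiffOn ℝ 1 g (Ioi 0) := by
    intro g g' hg hg'
    rw [show (1 : WithTop ℕ∞) = 0 + 1 by simp, contDiffOn_succ_iff_deriv_of_isOpen isOpen_Ioi]
    refine ⟨fun x hx => (hg x hx).differentiableAt.differentiableWithinAt, by simp, ?_⟩
    rw [contDiffOn_zero]
    exact hg'.congr fun x hx => (hg x hx).deriv
  have hf1 : ContDiffOn ℝ 1 f (Ioi 0) := hC1 h.left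
    (h.continuousOn_right.sub ((div_ofReal_continuousOn _).mul h.continuousOn_left))
  have hw1 : ContDiffOn ℝ 1 w (Ioi 0) := hC1 h.right
    (((div_ofReal_continuousOn _).mul h.continuousOn_right).add
      (continuousOn_const.mul h.continuousOn_left))
  rw [show (2 : WithTop ℕ∞) = 1 + 1 by norm_num, contDiffOn_succ_iff_deriv_of_isOpen isOpen_Ioi]
  refine ⟨fun x hx => (h.left x hx).differentiableAt.differentiableWithinAt, by simp, ?_⟩
  exact (hw1.sub (hdiv.mul hf1)).congr fun x hx => (h.left x hx).deriv

/-- A solution with `f, ∂_ν f ∈ L²` tends to zero at infinity, since `|f|²` and its derivative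
are integrable there. -/
lemma mem_boundedSolutions (h : IsSolutionPair ν a f w)
    (hf : MemLp f 2 (volume.restrict (Ioi (0 : ℝ))))
    (hw : MemLp w 2 (volume.restrict (Ioi (0 : ℝ)))) : f ∈ boundedSolutions ν a := by
  refine ⟨h.contDiffOn, fun x hx => ?_, ?_⟩
  · have e : bd ν f =ᶠ[𝓝 x] w := by
      filter_upwards [Ioi_mem_nhds hx] with y hy
      exact h.bd_eq hy
    rw [bdStar, e.deriv_eq, e.eq_of_nhds, (h.right x hx).deriv]
    ring
  · have hsub : Ioi (1 : ℝ) ⊆ Ioi 0 := Ioi_subset_Ioi zero_le_one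
    have i1 : IntegrableOn (fun x => f x * starRingEnd ℂ (f x)) (Ioi 1) :=
      IntegrableOn.mono_set (hf.integrable_mul hf.star) hsub
    have i2 : IntegrableOn (fun x => w x * starRingEnd ℂ (f x)) (Ioi 1) :=
      IntegrableOn.mono_set (hw.integrable_mul hf.star) hsub
    have i3 : IntegrableOn (fun x => f x * starRingEnd ℂ (w x)) (Ioi 1) :=
      IntegrableOn.mono_set (hf.integrable_mul hw.star) hsub
    have i4 : IntegrableOn (fun x => (((2 * ν - 1) / x : ℝ) : ℂ)
        * (f x * starRingEnd ℂ (f x))) (Ioi 1) := by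
      refine i1.bdd_mul (c := |2 * ν - 1|)
        (((div_ofReal_continuousOn _).mono hsub).aestronglyMeasurable measurableSet_Ioi) ?_
      filter_upwards [ae_restrict_mem measurableSet_Ioi] with x hx
      have hx' : (1 : ℝ) < x := hx
      rw [Complex.norm_real, Real.norm_eq_abs, abs_div, abs_of_pos (one_pos.trans hx')]
      exact div_le_self (abs_nonneg _) hx'.le
    have hlim := tendsto_zero_of_hasDerivAt_of_integrableOn_Ioi
      (fun x hx => h.hasDerivAt_mul_conj (hsub hx)) ((i2.add i3).sub i4) i1
    have hev := hlim.norm.eventually_le_const (u := 1) (by simp)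
    obtain ⟨R, hR⟩ := eventually_atTop.1 hev
    refine ⟨R, 1, fun x hx => ?_⟩
    have := hR x hx
    rw [norm_mul, RCLike.norm_conj] at this
    nlinarith [norm_nonneg (f x)]

end IsSolutionPair

lemma L2.HasTrace.hasWeightedTrace {κ : ℝ} {u : L2} {c : ℂ} (h : u.HasTrace κ c) {f : ℝ → ℂ}
    (hf : ContinuousOn f (Ioi 0))
    (huf : ∀ᵐ x ∂volume.restrict (Ioi (0 : ℝ)), u x = f x) : HasWeightedTrace κ f c := by
  obtain ⟨g, hg, hug, hc⟩ := h
  have : EqOn g f (Ioi 0) := Measure.eqOn_open_of_ae_eq (μ := volume)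
    (by filter_upwards [huf, hug] with x h1 h2; rw [← h1, ← h2]) isOpen_Ioi hg hf
  refine hc.congr' ?_
  filter_upwards [self_mem_nhdsWithin] with x hx
  rw [this hx]

/-- An element of `ℋ²` annihilated by `P` belongs to `ℳ₊`, with the same traces. -/
lemma exists_mem_boundedSolutions {ν : ℝ} (h0 : 0 < ν) (h1 : ν < 1) {a : ℂ} {U : H2 ν}
    (hU : opH2 ν a U = 0) : ∃ f ∈ boundedSolutions ν a,
      HasWeightedTrace (ν - 1 / 2) f (gammaMinus ν h0 (H2.toH1 ν U)) ∧
      HasWeightedTrace (1 / 2 - ν) (bd ν f) (gammaPlus ν h1 U) := by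
  obtain ⟨f, w, hfw, hf, hw⟩ := exists_isSolutionPair hU
  refine ⟨f, hfw.mem_boundedSolutions ((Lp.memLp _).ae_eq hf) ((Lp.memLp _).ae_eq hw),
    (traceOf_spec _ _ (H1.exists_trace h0) _).hasWeightedTrace hfw.continuousOn_left hf, ?_⟩
  refine ((traceOf_spec _ _ (H2.exists_trace h1) U).hasWeightedTrace
    hfw.continuousOn_right hw).congr' ?_
  filter_upwards [self_mem_nhdsWithin] with x hx
  rw [hfw.bd_eq hx]

/-! ### Uniqueness for `ν ≥ 1` -/

lemma exists_tendsto_of_integrableOn_deriv {E : Type} [NormedAddCommGroup E] [NormedSpace ℝ E]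
    [CompleteSpace E] {q q' : ℝ → E} (hq : ∀ x, 0 < x → HasDerivAt q (q' x) x)
    (hi : IntegrableOn q' (Ioc 0 1)) : ∃ c, Tendsto q (𝓝[>] 0) (𝓝 c) := by
  have hi' : IntervalIntegrable q' volume 0 1 :=
    (intervalIntegrable_iff_integrableOn_Ioc_of_le zero_le_one).2 hi
  have h1 := intervalIntegral.continuousOn_primitive_interval' (a := 1) hi' right_mem_uIcc
  rw [uIcc_of_le zero_le_one] at h1
  have h2 : Tendsto (fun b => ∫ x in (1:ℝ)..b, q' x) (𝓝[>] 0) (𝓝 (∫ x in (1:ℝ)..0, q' x)) :=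
    (h1 0 (by simp)).mono_left (by
      rw [← nhdsWithin_Ioc_eq_nhdsGT (zero_lt_one' ℝ)]
      exact nhdsWithin_mono _ Ioc_subset_Icc_self)
  refine ⟨_, (h2.const_add (q 1)).congr' ?_⟩
  filter_upwards [Ioc_mem_nhdsGT (zero_lt_one' ℝ)] with x hx
  have hx1 : IntervalIntegrable q' volume 1 x := hi'.mono_set (by
    rw [uIcc_of_ge hx.2, uIcc_of_le zero_le_one]
    exact Icc_subset_Icc_left hx.1.le)
  rw [intervalIntegral.integral_eq_sub_of_hasDerivAt (fun y hy => hq y ?_) hx1]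
  · abel
  · rw [uIcc_of_ge hx.2] at hy
    exact hx.1.trans_le hy.1

/-- If `q` has a limit at zero and `q x / x` is integrable there, the limit is zero. -/
lemma eq_zero_of_tendsto_of_norm_le_mul {E : Type} [NormedAddCommGroup E] {q : ℝ → E} {c : E}
    (hq : Tendsto q (𝓝[>] 0) (𝓝 c)) {k : ℝ → ℝ} {δ : ℝ} (hδ : 0 < δ)
    (hk : IntegrableOn k (Ioc 0 δ)) (h : ∀ x ∈ Ioc 0 δ, ‖q x‖ ≤ x * k x) : c = 0 := by
  by_contra hc
  have hc' : 0 < ‖c‖ := norm_pos_iff.2 hc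
  have h1 := hq.norm.eventually_const_le (half_lt_self hc')
  obtain ⟨ε, hε, hε'⟩ := mem_nhdsGT_iff_exists_Ioc_subset.1 h1
  have hε0 : (0 : ℝ) < ε := hε
  set r := min ε δ with hr
  have hr0 : 0 < r := lt_min hε0 hδ
  have hint : IntervalIntegrable (fun x : ℝ => x⁻¹) volume 0 r := by
    rw [intervalIntegrable_iff_integrableOn_Ioc_of_le hr0.le]
    have hk' : IntegrableOn (fun x => 2 / ‖c‖ * k x) (Ioc 0 r) :=
      (hk.mono_set (Ioc_subset_Ioc_right (min_le_right _ _))).const_mul _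
    refine hk'.mono' measurable_inv.aestronglyMeasurable ?_
    filter_upwards [ae_restrict_mem measurableSet_Ioc] with x hx
    have hx0 : 0 < x := hx.1
    have hle : ‖c‖ / 2 ≤ x * k x :=
      (hε' ⟨hx.1, hx.2.trans (min_le_left _ _)⟩).trans
        (h x ⟨hx.1, hx.2.trans (min_le_right _ _)⟩)
    rw [norm_inv, Real.norm_of_nonneg hx0.le, inv_le_iff_one_le_mul₀ hx0]
    calc (1 : ℝ) = 2 / ‖c‖ * (‖c‖ / 2) := by field_simp
      _ ≤ 2 / ‖c‖ * (x * k x) := by gcongr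
      _ = _ := by ring
  rw [intervalIntegrable_inv_iff] at hint
  rcases hint with h | h
  · exact hr0.ne h
  · exact h left_mem_uIcc

/-- Green's formula for `ν ≥ 1` and an `L²` solution: the boundary term at zero vanishes. Since
`(x |f|²)' = 2 x Re (w f̄) - (2 ν - 2) |f|² ≤ 2 x |w f̄|`, where `w f̄` is bounded near zero,
`|f|² = O(x)`; therefore `|w f̄|² / x` is integrable, and `w f̄` can only tend to zero. -/
lemma IsSolutionPair.integral_energy_eq_zero {ν : ℝ} (hν : 1 ≤ ν) {a : ℂ} {f w : ℝ → ℂ}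
    (h : IsSolutionPair ν a f w) (hf : MemLp f 2 (volume.restrict (Ioi (0 : ℝ))))
    (hw : MemLp w 2 (volume.restrict (Ioi (0 : ℝ)))) :
    ∫ x in Ioi (0 : ℝ), (w x * starRingEnd ℂ (w x) + a * (f x * starRingEnd ℂ (f x))) = 0 := by
  set T : ℝ → ℂ := fun x => w x * starRingEnd ℂ (f x) with hT
  set F : ℝ → ℝ := fun x => ‖f x‖ ^ 2 with hF
  have iww : IntegrableOn (fun x => w x * starRingEnd ℂ (w x)) (Ioi 0) := hw.integrable_mul hw.star
  have iFF : IntegrableOn (fun x => f x * starRingEnd ℂ (f x)) (Ioi 0) :=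
    hf.integrable_mul hf.star
  have iT : IntegrableOn T (Ioi 0) := hw.integrable_mul hf.star
  have iF : IntegrableOn F (Ioi 0) := hf.integrable_norm_pow (by norm_num)
  have iW : IntegrableOn (fun x => ‖w x‖ ^ 2) (Ioi 0) := hw.integrable_norm_pow (by norm_num)
  have iT' := iww.add (iFF.const_mul a)
  have hTd := fun x (hx : (0 : ℝ) < x) => h.hasDerivAt_right_mul_conj hx
  have hTinf : Tendsto T atTop (𝓝 0) :=
    tendsto_zero_of_hasDerivAt_of_integrableOn_Ioi (fun x hx => hTd x hx) iT' iT
  obtain ⟨c, hc⟩ := exists_tendsto_of_integrableOn_deriv hTd (iT'.mono_set Ioc_subset_Ioi_self)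
  -- `T` is bounded near zero
  obtain ⟨δ, hδ, hδ'⟩ := mem_nhdsGT_iff_exists_Ioc_subset.1
    (hc.norm.eventually_le_const (lt_add_one ‖c‖))
  have hδ0 : (0 : ℝ) < δ := hδ
  set M := ‖c‖ + 1 with hM
  have hTM : ∀ x ∈ Ioc 0 δ, ‖T x‖ ≤ M := fun x hx => hδ' hx
  -- the function `x |f|²` tends to zero
  have hFd : ∀ x, 0 < x → HasDerivAt F (2 * (T x).re - (2 * ν - 1) / x * F x) x := by
    intro x hx
    have h1 := Complex.reCLM.hasFDerivAt.comp_hasDerivAt x (h.hasDerivAt_mul_conj hx)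
    have e : (fun y => f y * starRingEnd ℂ (f y)) = fun y => ((F y : ℝ) : ℂ) := by
      ext y
      rw [Complex.mul_conj']
      simp [hF]
    have e' : f x * starRingEnd ℂ (w x) = starRingEnd ℂ (T x) := by
      simp [hT, mul_comm]
    rw [e, e', congrFun e x, ← Complex.ofReal_mul] at h1
    refine h1.congr_deriv ?_
    simp only [Complex.reCLM_apply, Complex.sub_re, Complex.add_re, Complex.conj_re,
      Complex.ofReal_re]
    simp only [hT]
    ring
  have hqd : ∀ x, 0 < x →
      HasDerivAt (fun y => y * F y) (2 * (x * (T x).re) - (2 * ν - 2) * F x) x := by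
    intro x hx
    refine ((hasDerivAt_id x).mul (hFd x hx)).congr_deriv ?_
    simp only [id]
    field_simp
    ring
  have hq0 : Tendsto (fun y => y * F y) (𝓝[>] 0) (𝓝 0) := by
    have iF1 : IntegrableOn F (Ioc 0 1) := iF.mono_set Ioc_subset_Ioi_self
    have i1 : IntegrableOn (fun x : ℝ => x * (T x).re) (Ioc 0 1) := by
      refine Integrable.bdd_mul (c := 1) ?_ measurable_id.aestronglyMeasurable ?_
      · exact (iT.mono_set Ioc_subset_Ioi_self).re
      · filter_upwards [ae_restrict_mem measurableSet_Ioc] with x hx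
        exact (Real.norm_of_nonneg hx.1.le).trans_le hx.2
    obtain ⟨l, hl⟩ := exists_tendsto_of_integrableOn_deriv hqd
      ((i1.const_mul 2).sub (iF1.const_mul _))
    have := eq_zero_of_tendsto_of_norm_le_mul hl one_pos iF1 fun x hx => by
      rw [Real.norm_of_nonneg (mul_nonneg hx.1.le (sq_nonneg _))]
    rwa [this] at hl
  -- comparison with `M x²`
  have hFM : ∀ x ∈ Ioo 0 δ, F x ≤ M * x := by
    set r : ℝ → ℝ := fun x => M * x ^ 2 - x * F x with hr
    have hrd : ∀ x, 0 < x →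
        HasDerivAt r (M * (2 * x) - (2 * (x * (T x).re) - (2 * ν - 2) * F x)) x := by
      intro x hx
      refine (((hasDerivAt_pow 2 x).const_mul M).sub (hqd x hx)).congr_deriv ?_
      norm_num
    have hmono : MonotoneOn r (Ioo 0 δ) := by
      refine monotoneOn_of_deriv_nonneg (convex_Ioo _ _)
        (fun x hx => (hrd x hx.1).continuousAt.continuousWithinAt)
        (fun x hx => (hrd x (interior_subset hx).1).differentiableAt.differentiableWithinAt) ?_
      intro x hx
      have hx' := interior_subset hx
      rw [(hrd x hx'.1).deriv]
      have h1 : (T x).re ≤ M := (Complex.re_le_norm _).trans (hTM x (Ioo_subset_Ioc_self hx'))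
      have h2 : 0 ≤ (2 * ν - 2) * F x := mul_nonneg (by linarith) (sq_nonneg _)
      have h3 : x * (T x).re ≤ x * M := mul_le_mul_of_nonneg_left h1 hx'.1.le
      linarith
    have hr0 : Tendsto r (𝓝[>] 0) (𝓝 0) := by
      have h1 : Tendsto (fun x : ℝ => M * x ^ 2) (𝓝[>] 0) (𝓝 0) :=
        ((continuous_const.mul (continuous_pow 2)).tendsto' (0 : ℝ) 0 (by simp)).mono_left
          nhdsWithin_le_nhds
      simpa using h1.sub hq0
    intro x hx
    have hx0 : 0 ≤ r x := by
      refine le_of_tendsto hr0 ?_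
      filter_upwards [Ioc_mem_nhdsGT hx.1] with y hy
      exact hmono ⟨hy.1, hy.2.trans_lt hx.2⟩ hx hy.2
    have h2 : x * F x ≤ x * (M * x) := by
      simp only [hr] at hx0
      linarith
    exact le_of_mul_le_mul_left h2 hx.1
  have hc0 : c = 0 := by
    have hδ2 : 0 < δ / 2 := half_pos hδ0
    refine (pow_eq_zero_iff two_ne_zero).1 (eq_zero_of_tendsto_of_norm_le_mul (hc.pow 2) hδ2
      ((iW.mono_set Ioc_subset_Ioi_self).const_mul M) fun x hx => ?_)
    have h1 := hFM x ⟨hx.1, hx.2.trans_lt (half_lt_self hδ0)⟩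
    calc ‖T x ^ 2‖ = ‖w x‖ ^ 2 * F x := by
          rw [norm_pow, hT, norm_mul, RCLike.norm_conj, mul_pow]
      _ ≤ ‖w x‖ ^ 2 * (M * x) := by gcongr
      _ = _ := by ring
  rw [hc0] at hc
  have key := integral_Ioi_deriv_mul_eq_sub (fun x hx => h.right x hx)
    (fun x hx => hasDerivAt_conj (h.left x hx)) ?_ hc hTinf
  · rw [sub_zero] at key
    rw [← key]
    refine setIntegral_congr_fun measurableSet_Ioi fun x hx => ?_
    simp only [map_sub, map_mul, Complex.conj_ofReal]
    ring
  · refine iT'.congr_fun (fun x hx => ?_) measurableSet_Ioi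
    simp only [Pi.add_apply, Pi.mul_apply, map_sub, map_mul, Complex.conj_ofReal]
    ring

/-! ### The variational problem -/

/-- For `a ∉ (-∞, 0]` the segment from `1` to `a` does not contain zero. -/
lemma exists_pos_mul_add_le_norm {a : ℂ} (ha : a ∈ Complex.slitPlane) :
    ∃ c : ℝ, 0 < c ∧ ∀ s t : ℝ, 0 ≤ s → 0 ≤ t → c * (s + t) ≤ ‖(s : ℂ) + a * t‖ := by
  obtain ⟨θ, hθ, hmin⟩ := isCompact_Icc.exists_isMinOn (α := ℝ) (β := ℝ)
    (f := fun θ : ℝ => ‖((1 - θ : ℝ) : ℂ) + a * θ‖)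
    (nonempty_Icc.2 (zero_le_one' ℝ)) (by fun_prop)
  have hne : ((1 - θ : ℝ) : ℂ) + a * θ ≠ 0 := by
    refine Complex.slitPlane_ne_zero ?_
    have := Complex.starConvex_one_slitPlane ha (sub_nonneg.2 hθ.2) hθ.1 (sub_add_cancel 1 θ)
    simpa [Complex.real_smul, mul_comm a] using this
  refine ⟨_, norm_pos_iff.2 hne, fun s t hs ht => ?_⟩
  rcases (add_nonneg hs ht).eq_or_lt with h0 | h0
  · rw [← h0, mul_zero]
    exact norm_nonneg _
  have h1 : ‖((1 - θ : ℝ) : ℂ) + a * θ‖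
      ≤ ‖((1 - t / (s + t) : ℝ) : ℂ) + a * (t / (s + t) : ℝ)‖ :=
    hmin ⟨by positivity, (div_le_one h0).2 (by linarith)⟩
  have h2 : (s : ℂ) + a * t
      = ((s + t : ℝ) : ℂ) * (((1 - t / (s + t) : ℝ) : ℂ) + a * (t / (s + t) : ℝ)) := by
    have : ((s + t : ℝ) : ℂ) ≠ 0 := Complex.ofReal_ne_zero.2 h0.ne'
    push_cast at this ⊢
    field_simp
    ring
  rw [h2, norm_mul, Complex.norm_real, Real.norm_of_nonneg h0.le, mul_comm]
  gcongr

lemma opH1_apply (ν : ℝ) (a : ℂ) (u v : H1 ν) :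
    opH1 ν a u v = inner ℂ (H1.d ν v) (H1.d ν u)
      + a * inner ℂ (H1.incl ν v) (H1.incl ν u) := rfl

/-- The form of `P` is coercive in modulus on `ℋ¹`. -/
lemma opH1_coercive (ν : ℝ) {a : ℂ} (ha : a ∈ Complex.slitPlane) :
    ∃ c : ℝ, 0 < c ∧ ∀ u : H1 ν, c * ‖u‖ ^ 2 ≤ ‖opH1 ν a u u‖ := by
  obtain ⟨c, hc, h⟩ := exists_pos_mul_add_le_norm ha
  refine ⟨c, hc, fun u => ?_⟩
  have e : ‖u‖ ^ 2 = ‖H1.incl ν u‖ ^ 2 + ‖H1.d ν u‖ ^ 2 := WithLp.prod_norm_sq_eq_of_L2 u.1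
  have := h (‖H1.d ν u‖ ^ 2) (‖H1.incl ν u‖ ^ 2) (sq_nonneg _) (sq_nonneg _)
  rw [opH1_apply, inner_self_eq_norm_sq_to_K, inner_self_eq_norm_sq_to_K, e, add_comm (_ ^ 2)]
  exact_mod_cast this

lemma opH1_bijective (ν : ℝ) {a : ℂ} (ha : a ∈ Complex.slitPlane) :
    Function.Bijective (opH1 ν a) := by
  obtain ⟨c, hc, h⟩ := opH1_coercive ν ha
  exact bijective_of_coercive _ hc h

lemma H2.eq_zero_of_opH2 {ν : ℝ} {a : ℂ} {U : H2 ν} (h : opH2 ν a U = 0)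
    (h1 : H2.toH1 ν U = 0) : U = 0 := by
  have hdd : H2.dd ν U = 0 := by
    have e : H2.dd ν U + a • H1.incl ν (H2.toH1 ν U) = 0 := h
    rwa [h1, map_zero, smul_zero, add_zero] at e
  exact Subtype.ext (WithLp.ofLp_injective 2 (Prod.ext h1 hdd))

/-- Green's formula for `P`. -/
lemma opH1_add_gamma {ν : ℝ} (h0 : 0 < ν) (h1 : ν < 1) (a : ℂ) (U : H2 ν) (v : H1 ν) :
    opH1 ν a (H2.toH1 ν U) v + gammaPlus ν h1 U * starRingEnd ℂ (gammaMinus ν h0 v)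
      = inner ℂ (H1.incl ν v) (opH2 ν a U) := by
  have e : inner ℂ (H1.incl ν v) (opH2 ν a U) = inner ℂ (H1.incl ν v) (H2.dd ν U)
      + a * inner ℂ (H1.incl ν v) (H2.incl ν U) := by
    simp [opH2, inner_add_right, inner_smul_right]
  rw [e, green h0 h1, opH1_apply]
  simp only [H2.incl, H2.d, ContinuousLinearMap.comp_apply]
  ring

/-- Solvability of the Neumann problem `P u = f`, `γ₊ u = t`: the variational solution of
`⟨D_ν u, D_ν v⟩ + a ⟨u, v⟩ = ⟨f, v⟩ - t conj (γ₋ v)` has `γ₊ u = t` because `γ₋ ≠ 0`. -/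
lemma exists_opH2_eq_gammaPlus_eq {ν : ℝ} (h0 : 0 < ν) (h1 : ν < 1) {a : ℂ}
    (ha : a ∈ Complex.slitPlane) (f : L2) (t : ℂ) :
    ∃ U : H2 ν, opH2 ν a U = f ∧ gammaPlus ν h1 U = t := by
  obtain ⟨u, hu⟩ := (opH1_bijective ν ha).2
    (pairing (ContinuousLinearMap.id ℂ L2) (H1.incl ν) f
      - pairing (ContinuousLinearMap.id ℂ ℂ) (gammaMinus ν h0) t)
  have hu' : ∀ v, opH1 ν a u v
      = inner ℂ (H1.incl ν v) f - t * starRingEnd ℂ (gammaMinus ν h0 v) := fun v => by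
    rw [hu]
    rfl
  obtain ⟨U, rfl, hUf⟩ := exists_H2_of_opH1_eq (a := a) (u := u) (f := f) fun φ hφ => by
    rw [hu', hφ.gammaMinus_toH1 h0, map_zero, mul_zero, sub_zero]
  refine ⟨U, hUf, ?_⟩
  obtain ⟨v, hv⟩ := exists_gammaMinus_eq_one h0 h1
  have := opH1_add_gamma h0 h1 a U v
  rw [hu', hUf, hv, map_one] at this
  linear_combination this

/-- Uniqueness for the Neumann problem: by Green's formula the form of `P` vanishes at `(u, ·)`. -/
lemma eq_zero_of_opH2_gammaPlus {ν : ℝ} (h0 : 0 < ν) (h1 : ν < 1) {a : ℂ}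
    (ha : a ∈ Complex.slitPlane) {U : H2 ν} (hU : opH2 ν a U = 0) (hγ : gammaPlus ν h1 U = 0) :
    U = 0 := by
  refine H2.eq_zero_of_opH2 hU ((injective_iff_map_eq_zero _).1 (opH1_bijective ν ha).1 _ ?_)
  ext v
  have := opH1_add_gamma h0 h1 a U v
  rwa [hγ, zero_mul, add_zero, hU, inner_zero_right] at this

/-! ### The case `ν ≥ 1` -/

/-- Injectivity is Green's formula without boundary terms, which holds for `ν ≥ 1`. -/
lemma opH2_bijective {ν : ℝ} (hν : 1 ≤ ν) {a : ℂ} (ha : a ∈ Complex.slitPlane) :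
    Function.Bijective (opH2 ν a) := by
  constructor
  · refine (injective_iff_map_eq_zero _).2 fun U hU => H2.eq_zero_of_opH2 hU ?_
    obtain ⟨f, w, hfw, hf, hw⟩ := exists_isSolutionPair hU
    have hfm := (Lp.memLp (H2.incl ν U)).ae_eq hf
    have hwm := (Lp.memLp (H2.d ν U)).ae_eq hw
    have hz : opH1 ν a (H2.toH1 ν U) (H2.toH1 ν U) = 0 := by
      refine Eq.trans ?_ (hfw.integral_energy_eq_zero hν hfm hwm)
      have e1 : inner ℂ (H2.d ν U) (H2.d ν U)
          = ∫ x in Ioi (0 : ℝ), w x * starRingEnd ℂ (w x) := by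
        rw [MeasureTheory.L2.inner_def]
        refine integral_congr_ae ?_
        filter_upwards [hw] with x hx
        rw [hx, RCLike.inner_apply]
      have e2 : inner ℂ (H2.incl ν U) (H2.incl ν U)
          = ∫ x in Ioi (0 : ℝ), f x * starRingEnd ℂ (f x) := by
        rw [MeasureTheory.L2.inner_def]
        refine integral_congr_ae ?_
        filter_upwards [hf] with x hx
        rw [hx, RCLike.inner_apply]
      have e3 := integral_add (hwm.integrable_mul hwm.star)
        ((hfm.integrable_mul hfm.star).const_mul a)
      rw [integral_const_mul] at e3
      exact (congrArg₂ (fun y z => y + a * z) e1 e2).trans e3.symm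
    obtain ⟨c, hc, h⟩ := opH1_coercive ν ha
    have h1 := h (H2.toH1 ν U)
    rw [hz, norm_zero] at h1
    by_contra hne
    have : 0 < c * ‖H2.toH1 ν U‖ ^ 2 := by
      have := norm_pos_iff.2 hne
      positivity
    linarith
  · intro f
    obtain ⟨u, hu⟩ := (opH1_bijective ν ha).2
      (pairing (ContinuousLinearMap.id ℂ L2) (H1.incl ν) f)
    obtain ⟨U, -, hUf⟩ := exists_H2_of_opH1_eq (a := a) (u := u) (f := f) fun φ hφ => by
      rw [hu]
      rfl
    exact ⟨U, hUf⟩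

lemma conj_mem_slitPlane {a : ℂ} (ha : a ∈ Complex.slitPlane) :
    starRingEnd ℂ a ∈ Complex.slitPlane := by
  rw [Complex.mem_slitPlane_iff] at ha ⊢
  simpa using ha

lemma opH0_bijective {ν : ℝ} (hν : 1 ≤ ν) {a : ℂ} (ha : a ∈ Complex.slitPlane) :
    Function.Bijective (opH0 ν a) :=
  pairing_id_bijective (opH2_bijective hν (conj_mem_slitPlane ha))

lemma continuous_add_smul {E : Type} [NormedAddCommGroup E] [NormedSpace ℂ E] (A B : E) :
    Continuous fun a : ℂ => A + a • B := by
  fun_prop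

lemma continuous_opH2 (ν : ℝ) : Continuous (opH2 ν) :=
  continuous_add_smul (H2.dd ν) (H2.incl ν)

lemma continuous_opH1 (ν : ℝ) : Continuous (opH1 ν) :=
  continuous_add_smul (pairing (H1.d ν) (H1.d ν)) (pairing (H1.incl ν) (H1.incl ν))

lemma continuous_opH0 (ν : ℝ) : Continuous (opH0 ν) := by
  have : opH0 ν = fun a => pairing (ContinuousLinearMap.id ℂ L2) (H2.dd ν)
      + a • pairing (ContinuousLinearMap.id ℂ L2) (H2.incl ν) := by
    ext a u v
    have e : opH0 ν a u v
      = inner ℂ (H2.dd ν v + starRingEnd ℂ a • H2.incl ν v) u := rfl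
    rw [e, inner_add_left, inner_smul_left, Complex.conj_conj]
    rfl
  rw [this]
  exact continuous_add_smul (pairing (ContinuousLinearMap.id ℂ L2) (H2.dd ν)) _

/-! ### The boundary value problem for `0 < ν < 1` -/

/-- The boundary data `(γ₋ U, γ₊ U)` of `U ∈ ℋ²`. -/
def H2.bdata {ν : ℝ} (h0 : 0 < ν) (h1 : ν < 1) (U : H2 ν) : BData :=
  WithLp.toLp 2 ![gammaMinus ν h0 (H2.toH1 ν U), gammaPlus ν h1 U]

/-- The Lopatinskii condition says that the linear system for the multiple of the decaying
solution `U` and for `u'` is injective. -/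
lemma Lopatinskii.injective {ν : ℝ} (h0 : 0 < ν) (h1 : ν < 1) {J : ℕ} {p : Coeffs J}
    (hp : Lopatinskii ν p) {U : H2 ν}
    (hU : opH2 ν p.1 U = 0) (hγ : gammaPlus ν h1 U = 1) (t : ℂ) (u' : Fin J → ℂ)
    (h : p.2.1.mulVec (t • (H2.bdata h0 h1 U).ofLp) + p.2.2.mulVec u' = 0) : t = 0 ∧ u' = 0 := by
  have htU : opH2 ν p.1 (t • U) = 0 := by rw [map_smul, hU, smul_zero]
  obtain ⟨f, hf, hm, hpl⟩ := exists_mem_boundedSolutions h0 h1 htU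
  have e : ![gammaMinus ν h0 (H2.toH1 ν (t • U)), gammaPlus ν h1 (t • U)]
      = t • (H2.bdata h0 h1 U).ofLp := by
    simp [H2.bdata]
  obtain ⟨hf0, hu⟩ := hp f hf _ _ u' hm hpl (by rw [e]; exact h)
  -- The solution `t U` vanishes, and its trace `γ₊` is `t`.
  refine ⟨?_, hu⟩
  rw [map_smul, hγ, smul_eq_mul, mul_one] at hpl
  refine tendsto_nhds_unique hpl (tendsto_const_nhds.congr' ?_)
  filter_upwards [self_mem_nhdsWithin] with x hx
  have : f =ᶠ[𝓝 x] fun _ => 0 := by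
    filter_upwards [Ioi_mem_nhds hx] with y hy
    exact hf0 y hy
  rw [bd, this.deriv_eq, this.eq_of_nhds]
  simp

/-- `U ∈ ℋ²` as an element of `ℋ̃²`. -/
def Ht2.ofH2 {ν : ℝ} (h0 : 0 < ν) (h1 : ν < 1) (U : H2 ν) : Ht2 ν h0 h1 :=
  ⟨WithLp.toLp 2 (U, H2.bdata h0 h1 U), rfl, rfl⟩

/-- `(u, γ₋ u, t)` as an element of `ℋ̃¹`. -/
def Ht1.ofH1 {ν : ℝ} (h0 : 0 < ν) (u : H1 ν) (t : ℂ) : Ht1 ν h0 :=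
  ⟨WithLp.toLp 2 (u, WithLp.toLp 2 ![gammaMinus ν h0 u, t]), rfl⟩

lemma bvp2_bijective {ν : ℝ} (h0 : 0 < ν) (h1 : ν < 1) {J : ℕ} {p : Coeffs J}
    (hp : p ∈ regularCoeffs ν J) :
    Function.Bijective (bvp2 ν h0 h1 p) := by
  obtain ⟨U, hU, hγ⟩ := exists_opH2_eq_gammaPlus_eq h0 h1 hp.1 0 1
  refine bvp_bijective (e := Ht2.ofH2 h0 h1 U) hU hγ (fun x hx hx1 => ?_) (fun f => ?_)
    (Lopatinskii.injective h0 h1 hp.2 hU hγ)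
  · have hfn : Ht2.fn ν h0 h1 x = 0 :=
      eq_zero_of_opH2_gammaPlus h0 h1 hp.1 hx (x.2.2.symm.trans hx1)
    refine Subtype.ext (WithLp.ofLp_injective 2 (Prod.ext hfn ?_))
    ext i
    fin_cases i
    · refine x.2.1.trans ?_
      change gammaMinus ν h0 (H2.toH1 ν (Ht2.fn ν h0 h1 x)) = 0
      rw [hfn, map_zero, map_zero]
    · exact hx1
  · obtain ⟨V, hV, -⟩ := exists_opH2_eq_gammaPlus_eq h0 h1 hp.1 f 0
    exact ⟨Ht2.ofH2 h0 h1 V, hV⟩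

lemma opHt1_apply {ν : ℝ} (h0 : 0 < ν) (a : ℂ) (x : Ht1 ν h0) (v : H1 ν) :
    opHt1 ν h0 a x v = opH1 ν a (Ht1.fn ν h0 x) v
      + Ht1.bdry ν h0 x 1 * starRingEnd ℂ (gammaMinus ν h0 v) := rfl

lemma bvp1_bijective {ν : ℝ} (h0 : 0 < ν) (h1 : ν < 1) {J : ℕ} {p : Coeffs J}
    (hp : p ∈ regularCoeffs ν J) :
    Function.Bijective (bvp1 ν h0 p) := by
  obtain ⟨U, hU, hγ⟩ := exists_opH2_eq_gammaPlus_eq h0 h1 hp.1 0 1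
  refine bvp_bijective (e := Ht1.ofH1 h0 (H2.toH1 ν U) (gammaPlus ν h1 U)) ?_ hγ
    (fun x hx hx1 => ?_) (fun l => ?_) (Lopatinskii.injective h0 h1 hp.2 hU hγ)
  · ext v
    rw [opHt1_eq h0 h1 p.1 U _ rfl rfl v, hU, inner_zero_right]
    rfl
  · have hfn : Ht1.fn ν h0 x = 0 := by
      refine (injective_iff_map_eq_zero _).1 (opH1_bijective ν hp.1).1 _ ?_
      ext v
      have := DFunLike.congr_fun hx v
      rwa [opHt1_apply, hx1, zero_mul, add_zero] at this
    refine Subtype.ext (WithLp.ofLp_injective 2 (Prod.ext hfn ?_))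
    ext i
    fin_cases i
    · refine x.2.trans ?_
      change gammaMinus ν h0 (Ht1.fn ν h0 x) = 0
      rw [hfn, map_zero]
    · exact hx1
  · obtain ⟨u, rfl⟩ := (opH1_bijective ν hp.1).2 l
    refine ⟨Ht1.ofH1 h0 u 0, ?_⟩
    ext v
    rw [opHt1_apply]
    change _ + 0 * _ = _
    rw [zero_mul, add_zero]
    rfl

/-- The operator `U ↦ (P U, γ₊ U)` of the Neumann problem on `ℋ²`. -/
def neumann (ν : ℝ) (h1 : ν < 1) (a : ℂ) : H2 ν →L[ℂ] WithLp 2 (L2 × ℂ) :=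
  ((WithLp.prodContinuousLinearEquiv 2 ℂ L2 ℂ).symm : L2 × ℂ →L[ℂ] WithLp 2 (L2 × ℂ)).comp
    ((opH2 ν a).prod (gammaPlus ν h1))

lemma neumann_bijective {ν : ℝ} (h0 : 0 < ν) (h1 : ν < 1) {a : ℂ}
    (ha : a ∈ Complex.slitPlane) :
    Function.Bijective (neumann ν h1 a) := by
  refine ⟨(injective_iff_map_eq_zero _).2 fun U hU => ?_, fun y => ?_⟩
  · exact eq_zero_of_opH2_gammaPlus h0 h1 ha (congrArg WithLp.fst hU) (congrArg WithLp.snd hU)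
  · obtain ⟨U, hU, hγ⟩ := exists_opH2_eq_gammaPlus_eq h0 h1 ha y.fst y.snd
    exact ⟨U, WithLp.ofLp_injective 2 (Prod.ext hU hγ)⟩

/-- With `φ₊ = 0`, the operator `P : ℋ̃⁰ → ℋ⁻²` is the adjoint of the Neumann problem for `P^*`. -/
lemma opHt0_apply {ν : ℝ} (h0 : 0 < ν) (h1 : ν < 1) (a : ℂ) (x : Ht0) (v : H2 ν) :
    opHt0 ν h0 h1 a x v
      = pairing (ContinuousLinearMap.id ℂ _) (neumann ν h1 (starRingEnd ℂ a))
          (WithLp.toLp 2 (Ht0.fn x, -Ht0.bdry x 0)) v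
        + Ht0.bdry x 1 * starRingEnd ℂ (gammaMinus ν h0 (H2.toH1 ν v)) := by
  have e : opHt0 ν h0 h1 a x v = inner ℂ (opH2 ν (starRingEnd ℂ a) v) (Ht0.fn x)
      + Ht0.bdry x 1 * starRingEnd ℂ (gammaMinus ν h0 (H2.toH1 ν v))
      - Ht0.bdry x 0 * starRingEnd ℂ (gammaPlus ν h1 v) := rfl
  have e' : pairing (ContinuousLinearMap.id ℂ _) (neumann ν h1 (starRingEnd ℂ a))
      (WithLp.toLp 2 (Ht0.fn x, -Ht0.bdry x 0)) v
      = inner ℂ (opH2 ν (starRingEnd ℂ a) v) (Ht0.fn x)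
        + -Ht0.bdry x 0 * starRingEnd ℂ (gammaPlus ν h1 v) := by
    rw [pairing_apply, WithLp.prod_inner_apply]
    rfl
  rw [e, e']
  ring

lemma bvp0_bijective {ν : ℝ} (h0 : 0 < ν) (h1 : ν < 1) {J : ℕ} {p : Coeffs J}
    (hp : p ∈ regularCoeffs ν J) :
    Function.Bijective (bvp0 ν h0 h1 p) := by
  obtain ⟨U, hU, hγ⟩ := exists_opH2_eq_gammaPlus_eq h0 h1 hp.1 0 1
  have hN := pairing_id_bijective (neumann_bijective h0 h1 (conj_mem_slitPlane hp.1))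
  refine bvp_bijective (e := (WithLp.toLp 2 (H2.incl ν U, H2.bdata h0 h1 U) : Ht0)) ?_ hγ
    (fun x hx hx1 => ?_) (fun l => ?_) (Lopatinskii.injective h0 h1 hp.2 hU hγ)
  · ext v
    rw [opHt0_eq h0 h1 p.1 U _ rfl rfl rfl v, hU, inner_zero_right]
    rfl
  · have hz : (WithLp.toLp 2 (Ht0.fn x, -Ht0.bdry x 0) : WithLp 2 (L2 × ℂ)) = 0 := by
      refine (injective_iff_map_eq_zero _).1 hN.1 _ ?_
      ext v
      have := DFunLike.congr_fun hx v
      rwa [opHt0_apply, hx1, zero_mul, add_zero] at this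
    refine WithLp.ofLp_injective 2 (Prod.ext (congrArg (fun y : WithLp 2 (L2 × ℂ) => y.fst) hz) ?_)
    ext i
    fin_cases i
    · exact neg_eq_zero.1 (congrArg (fun y : WithLp 2 (L2 × ℂ) => y.snd) hz)
    · exact hx1
  · obtain ⟨y, rfl⟩ := hN.2 l
    refine ⟨WithLp.toLp 2 (y.fst, WithLp.toLp 2 ![-y.snd, 0]), ?_⟩
    ext v
    rw [opHt0_apply]
    change pairing _ _ (WithLp.toLp 2 (y.fst, - -y.snd)) v + 0 * _ = _
    rw [zero_mul, add_zero, neg_neg]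
    rfl

lemma continuous_opHt2 {ν : ℝ} (h0 : 0 < ν) (h1 : ν < 1) : Continuous (opHt2 ν h0 h1) :=
  (continuous_opH2 ν).clm_comp_const _

lemma continuous_opHt1 {ν : ℝ} (h0 : 0 < ν) : Continuous (opHt1 ν h0) :=
  ((continuous_opH1 ν).clm_comp_const _).add continuous_const

lemma continuous_opHt0 {ν : ℝ} (h0 : 0 < ν) (h1 : ν < 1) : Continuous (opHt0 ν h0 h1) :=
  (((continuous_opH0 ν).clm_comp_const _).add continuous_const).sub continuous_const

end BesselBVP
end

theorem mainTheorem2 (ν : ℝ) :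
    (∀ (h0 : 0 < ν) (h1 : ν < 1) (J : ℕ),
      BesselBVP.IsContinuousIsoFamily (BesselBVP.bvp0 ν h0 h1 (J := J))
          (BesselBVP.regularCoeffs ν J) ∧
        BesselBVP.IsContinuousIsoFamily (BesselBVP.bvp1 ν h0 (J := J))
          (BesselBVP.regularCoeffs ν J) ∧
        BesselBVP.IsContinuousIsoFamily (BesselBVP.bvp2 ν h0 h1 (J := J))
          (BesselBVP.regularCoeffs ν J)) ∧
    (1 ≤ ν →
      BesselBVP.IsContinuousIsoFamily (BesselBVP.opH0 ν) Complex.slitPlane ∧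
        BesselBVP.IsContinuousIsoFamily (BesselBVP.opH1 ν) Complex.slitPlane ∧
        BesselBVP.IsContinuousIsoFamily (BesselBVP.opH2 ν) Complex.slitPlane) := by
  open BesselBVP in
  refine ⟨fun h0 h1 J => ⟨?_, ?_, ?_⟩, fun hν => ⟨?_, ?_, ?_⟩⟩
  · exact isContinuousIsoFamily_of_bijective
      (continuous_bvp ((continuous_opHt0 h0 h1).comp continuous_fst) _
        (continuous_fst.comp continuous_snd) (continuous_snd.comp continuous_snd))
      fun p hp => bvp0_bijective h0 h1 hp
  · exact isContinuousIsoFamily_of_bijective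
      (continuous_bvp ((continuous_opHt1 h0).comp continuous_fst) _
        (continuous_fst.comp continuous_snd) (continuous_snd.comp continuous_snd))
      fun p hp => bvp1_bijective h0 h1 hp
  · exact isContinuousIsoFamily_of_bijective
      (continuous_bvp ((continuous_opHt2 h0 h1).comp continuous_fst) _
        (continuous_fst.comp continuous_snd) (continuous_snd.comp continuous_snd))
      fun p hp => bvp2_bijective h0 h1 hp
  · exact isContinuousIsoFamily_of_bijective (continuous_opH0 ν) fun a ha => opH0_bijective hν ha
  · exact isContinuousIsoFamily_of_bijective (continuous_opH1 ν) fun a ha => opH1_bijective ν ha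
  · exact isContinuousIsoFamily_of_bijective (continuous_opH2 ν) fun a ha => opH2_bijective hν ha
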